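/- Let $N\ge 2$, let $\alpha<0$, and let $Y=\{y_1<\dots<y_N\}\subset(0,2\pi)$ be a set of $N$ points. Let $H_{\alpha,Y}$ be the Hamiltonian on a loop of length $2\pi$ with $\delta$-interactions of strength $\alpha$ at the points of $Y$, i.e. the operator in $L^2((0,2\pi))$ acting as $\psi\mapsto-\psi''$ on all $\psi\in H^2((0,2\pi)\setminus Y)$ with $$\psi(y_j+)=\psi(y_j-)=:\psi(y_j),\qquad \psi'(y_j+)-\psi'(y_j-)=\alpha\,\psi(y_j),\qquad j=1,\dots,N,$$ $$\psi(2\pi-)=\psi(0+),\qquad \psi'(2\pi-)=\psi'(0+).$$ Then $H_{\alpha,Y}$ has a lowest eigenvalue, denoted $\lambda_1(\alpha,Y)$ (the ground state eigenvalue). Put $\tilde Y:=\{\frac{\pi}{N}(2j-1)\}_{j=1}^N$. Then $$\lambda_1(\alpha,Y)\le\lambda_1(\alpha,\tilde Y),$$ and the inequality is strict if and only if $Y$ is not congruent with $\tilde Y$; here two subsets of $(0,2\pi)$ are called congruent if some isometry of the loop $\mathbb{R}/2\pi\mathbb{Z}$ with the arc-length distance maps one onto the other. -/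

import Mathlib

noncomputable section

open Real Set MeasureTheory Filter Topology

namespace PointInteraction

/-- The interval `I = (0, 2π)`, the loop cut open at one point. -/
def loopInterval : Set ℝ := Ioo 0 (2 * π)

/-- The Hilbert space `L²(I)` of complex-valued functions. -/
abbrev LoopL2 : Type := Lp ℂ 2 ((volume : Measure ℝ).restrict loopInterval)

/-- `IsInDomain α Y ψ ψ₁ ψ₂` says that `ψ` is of class `H²` on `I \ Y` with first derivative `ψ₁`
and second derivative `ψ₂` (that is, on `I \ Y` the function `ψ` is continuously differentiable,
its derivative is locally absolutely continuous, and the second derivative is in `L²`; on bounded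
intervals `ψ` and `ψ₁` are then automatically in `L²`), that `ψ` satisfies the `δ`-conditions of
strength `α` at the points of `Y`, and that it satisfies the periodic boundary conditions. -/
structure IsInDomain (α : ℝ) (Y : Finset ℝ) (ψ ψ₁ ψ₂ : ℝ → ℂ) : Prop where
  hasDerivAt : ∀ x ∈ loopInterval \ (Y : Set ℝ), HasDerivAt ψ (ψ₁ x) x
  memLp : MemLp ψ₂ 2 ((volume : Measure ℝ).restrict loopInterval)
  integral_eq : ∀ a b : ℝ, a ≤ b → Icc a b ⊆ loopInterval \ (Y : Set ℝ) →
    ψ₁ b - ψ₁ a = ∫ x in a..b, ψ₂ x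
  continuousAt : ∀ y ∈ Y, ContinuousAt ψ y
  jump : ∀ y ∈ Y, ∃ r l : ℂ, Tendsto ψ₁ (𝓝[>] y) (𝓝 r) ∧ Tendsto ψ₁ (𝓝[<] y) (𝓝 l) ∧
    r - l = (α : ℂ) * ψ y
  periodic : ∃ c : ℂ, Tendsto ψ (𝓝[>] 0) (𝓝 c) ∧ Tendsto ψ (𝓝[<] (2 * π)) (𝓝 c)
  periodic_deriv : ∃ d : ℂ, Tendsto ψ₁ (𝓝[>] 0) (𝓝 d) ∧ Tendsto ψ₁ (𝓝[<] (2 * π)) (𝓝 d)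

theorem IsInDomain.intervalIntegrable {α : ℝ} {Y : Finset ℝ} {ψ ψ₁ ψ₂ : ℝ → ℂ}
    (h : IsInDomain α Y ψ ψ₁ ψ₂) {a b : ℝ} (hab : a ≤ b)
    (hs : Icc a b ⊆ loopInterval \ (Y : Set ℝ)) : IntervalIntegrable ψ₂ volume a b := by
  have : IsFiniteMeasure ((volume : Measure ℝ).restrict loopInterval) :=
    ⟨by rw [Measure.restrict_apply_univ]; exact measure_Ioo_lt_top⟩
  have h1 : IntegrableOn ψ₂ loopInterval := h.memLp.integrable (by norm_num)
  rw [intervalIntegrable_iff_integrableOn_Icc_of_le hab]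
  exact h1.mono_set fun x hx => (hs hx).1

theorem IsInDomain.zero (α : ℝ) (Y : Finset ℝ) : IsInDomain α Y 0 0 0 where
  hasDerivAt x _ := hasDerivAt_const x (0 : ℂ)
  memLp := MemLp.zero'
  integral_eq a b _ _ := by simp
  continuousAt y _ := continuousAt_const
  jump y _ := ⟨0, 0, tendsto_const_nhds, tendsto_const_nhds, by simp⟩
  periodic := ⟨0, tendsto_const_nhds, tendsto_const_nhds⟩
  periodic_deriv := ⟨0, tendsto_const_nhds, tendsto_const_nhds⟩

theorem IsInDomain.add {α : ℝ} {Y : Finset ℝ} {ψ ψ₁ ψ₂ φ φ₁ φ₂ : ℝ → ℂ}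
    (h : IsInDomain α Y ψ ψ₁ ψ₂) (k : IsInDomain α Y φ φ₁ φ₂) :
    IsInDomain α Y (ψ + φ) (ψ₁ + φ₁) (ψ₂ + φ₂) where
  hasDerivAt x hx := (h.hasDerivAt x hx).add (k.hasDerivAt x hx)
  memLp := h.memLp.add k.memLp
  integral_eq a b hab hs := by
    have e := intervalIntegral.integral_add (h.intervalIntegrable hab hs)
      (k.intervalIntegrable hab hs)
    simp only [Pi.add_apply]
    rw [e, ← h.integral_eq a b hab hs, ← k.integral_eq a b hab hs]
    ring
  continuousAt y hy := (h.continuousAt y hy).add (k.continuousAt y hy)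
  jump y hy := by
    obtain ⟨r, l, h1, h2, h3⟩ := h.jump y hy
    obtain ⟨r', l', k1, k2, k3⟩ := k.jump y hy
    refine ⟨r + r', l + l', h1.add k1, h2.add k2, ?_⟩
    simp only [Pi.add_apply]
    linear_combination h3 + k3
  periodic := by
    obtain ⟨c, h1, h2⟩ := h.periodic
    obtain ⟨c', k1, k2⟩ := k.periodic
    exact ⟨c + c', h1.add k1, h2.add k2⟩
  periodic_deriv := by
    obtain ⟨c, h1, h2⟩ := h.periodic_deriv
    obtain ⟨c', k1, k2⟩ := k.periodic_deriv
    exact ⟨c + c', h1.add k1, h2.add k2⟩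

theorem IsInDomain.smul {α : ℝ} {Y : Finset ℝ} {ψ ψ₁ ψ₂ : ℝ → ℂ} (z : ℂ)
    (h : IsInDomain α Y ψ ψ₁ ψ₂) : IsInDomain α Y (z • ψ) (z • ψ₁) (z • ψ₂) where
  hasDerivAt x hx := (h.hasDerivAt x hx).const_smul z
  memLp := h.memLp.const_smul z
  integral_eq a b hab hs := by
    simp only [Pi.smul_apply]
    rw [intervalIntegral.integral_smul, ← h.integral_eq a b hab hs, smul_sub]
  continuousAt y hy := (h.continuousAt y hy).const_smul z
  jump y hy := by
    obtain ⟨r, l, h1, h2, h3⟩ := h.jump y hy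
    refine ⟨z • r, z • l, h1.const_smul z, h2.const_smul z, ?_⟩
    simp only [Pi.smul_apply, smul_eq_mul]
    linear_combination z * h3
  periodic := by
    obtain ⟨c, h1, h2⟩ := h.periodic
    exact ⟨z • c, h1.const_smul z, h2.const_smul z⟩
  periodic_deriv := by
    obtain ⟨c, h1, h2⟩ := h.periodic_deriv
    exact ⟨z • c, h1.const_smul z, h2.const_smul z⟩

theorem IsInDomain.ae_eq_zero {α : ℝ} {Y : Finset ℝ} {ψ ψ₁ ψ₂ : ℝ → ℂ}
    (h : IsInDomain α Y ψ ψ₁ ψ₂) (h0 : ψ =ᵐ[volume.restrict loopInterval] 0) :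
    ψ₂ =ᵐ[volume.restrict loopInterval] 0 := by
  have hopen : IsOpen (loopInterval \ (Y : Set ℝ)) := isOpen_Ioo.sdiff Y.finite_toSet.isClosed
  have hψ : EqOn ψ 0 (loopInterval \ (Y : Set ℝ)) :=
    Measure.eqOn_open_of_ae_eq (ae_restrict_of_ae_restrict_of_subset sdiff_subset h0) hopen
      (fun x hx => (h.hasDerivAt x hx).continuousAt.continuousWithinAt) continuousOn_const
  have hψ₁ : ∀ x ∈ loopInterval \ (Y : Set ℝ), ψ₁ x = 0 := by
    intro x hx
    have e : ψ =ᶠ[𝓝 x] fun _ => (0 : ℂ) := by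
      filter_upwards [hopen.mem_nhds hx] with t ht using hψ ht
    exact (h.hasDerivAt x hx).unique ((hasDerivAt_const x (0 : ℂ)).congr_of_eventuallyEq e)
  have hfin : IsFiniteMeasure ((volume : Measure ℝ).restrict loopInterval) :=
    ⟨by rw [Measure.restrict_apply_univ]; exact measure_Ioo_lt_top⟩
  have h1 : IntegrableOn ψ₂ loopInterval := h.memLp.integrable (by norm_num)
  have h2 : Integrable (loopInterval.indicator ψ₂) volume :=
    (integrable_indicator_iff measurableSet_Ioo).2 h1
  have hY : ∀ᵐ x ∂(volume : Measure ℝ), x ∉ (Y : Set ℝ) :=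
    measure_eq_zero_iff_ae_notMem.1 (Y.finite_toSet.measure_zero _)
  rw [EventuallyEq, loopInterval, ae_restrict_iff' measurableSet_Ioo]
  filter_upwards [LocallyIntegrable.ae_hasDerivAt_integral h2.locallyIntegrable, hY] with x hx hxY hxI
  change x ∈ loopInterval at hxI
  have hd := hx x
  rw [indicator_of_mem hxI] at hd
  obtain ⟨ε, hε, hball⟩ := Metric.isOpen_iff.1 hopen x ⟨hxI, hxY⟩
  have key : ∀ a b : ℝ, a ≤ b → Icc a b ⊆ loopInterval \ (Y : Set ℝ) →
      ∫ t in a..b, loopInterval.indicator ψ₂ t = 0 := by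
    intro a b hab hs
    have e : ∫ t in a..b, loopInterval.indicator ψ₂ t = ∫ t in a..b, ψ₂ t := by
      refine intervalIntegral.integral_congr fun t ht => ?_
      rw [uIcc_of_le hab] at ht
      exact indicator_of_mem (hs ht).1 ψ₂
    rw [e, ← h.integral_eq a b hab hs, hψ₁ a (hs (left_mem_Icc.2 hab)),
      hψ₁ b (hs (right_mem_Icc.2 hab)), sub_zero]
  have e : (fun b => ∫ t in x..b, loopInterval.indicator ψ₂ t) =ᶠ[𝓝 x] fun _ => (0 : ℂ) := by
    filter_upwards [Metric.ball_mem_nhds x hε] with b hb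
    have hconv := (convex_ball x ε).ordConnected
    rcases le_total x b with hle | hle
    · exact key x b hle ((hconv.out (Metric.mem_ball_self hε) hb).trans hball)
    · rw [intervalIntegral.integral_symm,
        key b x hle ((hconv.out hb (Metric.mem_ball_self hε)).trans hball), neg_zero]
  exact hd.unique ((hasDerivAt_const x (0 : ℂ)).congr_of_eventuallyEq e)

/-- The graph of `H_{α,Y}`: all pairs `(ψ, -ψ'')` with `ψ` in the operator domain. -/
def hamiltonianGraph (α : ℝ) (Y : Finset ℝ) : Submodule ℂ (LoopL2 × LoopL2) where
  carrier := {p | ∃ ψ ψ₁ ψ₂ : ℝ → ℂ, IsInDomain α Y ψ ψ₁ ψ₂ ∧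
    p.1 =ᵐ[volume.restrict loopInterval] ψ ∧ p.2 =ᵐ[volume.restrict loopInterval] -ψ₂}
  zero_mem' := ⟨0, 0, 0, IsInDomain.zero α Y, Lp.coeFn_zero _ _ _, by
    rw [neg_zero]; exact Lp.coeFn_zero _ _ _⟩
  add_mem' := by
    rintro p q ⟨ψ, ψ₁, ψ₂, h, h1, h2⟩ ⟨φ, φ₁, φ₂, k, k1, k2⟩
    refine ⟨ψ + φ, ψ₁ + φ₁, ψ₂ + φ₂, h.add k,
      (Lp.coeFn_add p.1 q.1).trans (h1.add k1), ?_⟩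
    rw [neg_add]
    exact (Lp.coeFn_add p.2 q.2).trans (h2.add k2)
  smul_mem' := by
    rintro z p ⟨ψ, ψ₁, ψ₂, h, h1, h2⟩
    refine ⟨z • ψ, z • ψ₁, z • ψ₂, h.smul z,
      (Lp.coeFn_smul z p.1).trans (h1.const_smul z), ?_⟩
    rw [← smul_neg]
    exact (Lp.coeFn_smul z p.2).trans (h2.const_smul z)

/-- The Hamiltonian `H_{α,Y} = -d²/dx² + α ∑_{y ∈ Y} δ(x - y)` on the loop, as an unbounded linear
operator in `L²(I)`. Its graph is `hamiltonianGraph α Y`, see `hamiltonian_graph`. -/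
def hamiltonian (α : ℝ) (Y : Finset ℝ) : LoopL2 →ₗ.[ℂ] LoopL2 :=
  (hamiltonianGraph α Y).toLinearPMap

theorem hamiltonian_graph (α : ℝ) (Y : Finset ℝ) :
    (hamiltonian α Y).graph = hamiltonianGraph α Y := by
  refine Submodule.toLinearPMap_graph_eq _ ?_
  rintro ⟨f, g⟩ ⟨ψ, ψ₁, ψ₂, h, h1, h2⟩ hf
  simp only at hf h1 h2 ⊢
  subst hf
  have h0 := h.ae_eq_zero (h1.symm.trans (Lp.coeFn_zero _ _ _))
  rw [Lp.eq_zero_iff_ae_eq_zero]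
  filter_upwards [h2, h0] with x hx hx0
  rw [hx, Pi.neg_apply, hx0]
  simp

/-- `μ` is an eigenvalue of the unbounded operator `T`. -/
def IsEigenvalue {E : Type*} [AddCommGroup E] [Module ℂ E] (T : E →ₗ.[ℂ] E) (μ : ℂ) : Prop :=
  ∃ x : T.domain, (x : E) ≠ 0 ∧ T x = μ • (x : E)

/-- The set of (real) eigenvalues of `H_{α,Y}`. -/
def energyLevels (α : ℝ) (Y : Finset ℝ) : Set ℝ :=
  {E : ℝ | IsEigenvalue (hamiltonian α Y) (E : ℂ)}

/-- The ground state eigenvalue `λ₁(α, Y)`, the lowest eigenvalue of `H_{α,Y}`. -/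
def groundState (α : ℝ) (Y : Finset ℝ) : ℝ := sInf (energyLevels α Y)

/-- The equidistant configuration `{π (2j - 1) / N : j = 1, …, N}`. -/
def equidistant (N : ℕ) : Finset ℝ :=
  (Finset.Icc 1 N).image fun j : ℕ => π / N * (2 * (j : ℝ) - 1)

/-- Two configurations on the loop `ℝ / 2πℤ` are congruent if an isometry of the loop (for the
arc-length distance) maps one onto the other. -/
def Congruent (Y Z : Finset ℝ) : Prop :=
  ∃ e : AddCircle (2 * π) ≃ᵢ AddCircle (2 * π),
    e '' ((fun y : ℝ => (y : AddCircle (2 * π))) '' (Y : Set ℝ)) =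
      (fun y : ℝ => (y : AddCircle (2 * π))) '' (Z : Set ℝ)

end PointInteraction

end

noncomputable section

open Real Set MeasureTheory Filter Topology

namespace PointInteraction

/-! For κ > 0, the number -κ² is an eigenvalue exactly when the symmetric matrix cosh(κ(π - |p -
q|)), p, q ∈ Y, has the eigenvalue 2κ sinh(κπ)/(-α) (`neg_sq_mem_energyLevels_iff`). Up to a factor,
this kernel is the Green's function of -d²/dx² + κ² on the loop, an operator with trivial kernel
(`IsSolution.eq_zero`). The ground state therefore belongs to the greatest such κ, which is the
largest zero of `greenMax`; the constant trial vector bounds it from below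
(`exists_isGreatest_isCritical`).

At the constant vector the quadratic form depends on Y only through the double sum of the kernel.
Group the ordered pairs by the number j of steps that separate them around the loop: arcs with the
same j have mean length 2πj/N, so Jensen's inequality for the strictly convex cosh shows that equal
gaps minimise the sum (`IsLoopSequence.sum_sum_greenKernel`). For equidistant points all row sums
coincide and bound every eigenvalue of the matrix (`IsCritical.le_of_rowSum`). Hence, at the
greatest critical number k of the equidistant set, the form of Y at the constant vector is
nonnegative, and k ≤ κ. It is positive unless all gaps agree, that is, unless Y is a rotation of the
equidistant set. Conversely, the kernel depends only on the loop distance, so congruent sets have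
the same critical numbers (`IsCritical.of_congruent`). -/

/-! ### Periodic solutions of ψ'' = κ²ψ with prescribed derivative jumps, and their uniqueness. -/

/-- `IsSolution κ Y J ψ ψ₁` says that `ψ` is a continuous periodic solution of `ψ'' = κ²ψ` off `Y`,
with derivative `ψ₁` that jumps by `J y` at each `y ∈ Y`. -/
structure IsSolution (κ : ℝ) (Y : Finset ℝ) (J ψ ψ₁ : ℝ → ℂ) : Prop where
  hasDerivAt : ∀ x ∈ loopInterval \ (Y : Set ℝ), HasDerivAt ψ (ψ₁ x) x
  hasDerivAt_deriv : ∀ x ∈ loopInterval \ (Y : Set ℝ), HasDerivAt ψ₁ ((κ : ℂ) ^ 2 * ψ x) x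
  continuousAt : ∀ y ∈ Y, ContinuousAt ψ y
  jump : ∀ y ∈ Y, ∃ r l : ℂ, Tendsto ψ₁ (𝓝[>] y) (𝓝 r) ∧ Tendsto ψ₁ (𝓝[<] y) (𝓝 l) ∧
    r - l = J y
  periodic : ∃ c : ℂ, Tendsto ψ (𝓝[>] 0) (𝓝 c) ∧ Tendsto ψ (𝓝[<] (2 * π)) (𝓝 c)
  periodic_deriv : ∃ d : ℂ, Tendsto ψ₁ (𝓝[>] 0) (𝓝 d) ∧ Tendsto ψ₁ (𝓝[<] (2 * π)) (𝓝 d)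

namespace IsSolution

variable {κ : ℝ} {Y : Finset ℝ} {J K ψ ψ₁ φ φ₁ : ℝ → ℂ}

theorem zero (κ : ℝ) (Y : Finset ℝ) : IsSolution κ Y 0 0 0 where
  hasDerivAt x _ := hasDerivAt_const x (0 : ℂ)
  hasDerivAt_deriv x _ := by simp
  continuousAt y _ := continuousAt_const
  jump y _ := ⟨0, 0, tendsto_const_nhds, tendsto_const_nhds, by simp⟩
  periodic := ⟨0, tendsto_const_nhds, tendsto_const_nhds⟩
  periodic_deriv := ⟨0, tendsto_const_nhds, tendsto_const_nhds⟩

theorem add (h : IsSolution κ Y J ψ ψ₁) (k : IsSolution κ Y K φ φ₁) :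
    IsSolution κ Y (J + K) (ψ + φ) (ψ₁ + φ₁) where
  hasDerivAt x hx := (h.hasDerivAt x hx).add (k.hasDerivAt x hx)
  hasDerivAt_deriv x hx := by
    simpa only [Pi.add_apply, mul_add] using (h.hasDerivAt_deriv x hx).add (k.hasDerivAt_deriv x hx)
  continuousAt y hy := (h.continuousAt y hy).add (k.continuousAt y hy)
  jump y hy := by
    obtain ⟨r, l, h1, h2, h3⟩ := h.jump y hy
    obtain ⟨r', l', k1, k2, k3⟩ := k.jump y hy
    refine ⟨r + r', l + l', h1.add k1, h2.add k2, ?_⟩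
    simp only [Pi.add_apply]
    linear_combination h3 + k3
  periodic := by
    obtain ⟨c, h1, h2⟩ := h.periodic
    obtain ⟨c', k1, k2⟩ := k.periodic
    exact ⟨c + c', h1.add k1, h2.add k2⟩
  periodic_deriv := by
    obtain ⟨c, h1, h2⟩ := h.periodic_deriv
    obtain ⟨c', k1, k2⟩ := k.periodic_deriv
    exact ⟨c + c', h1.add k1, h2.add k2⟩

theorem smul (z : ℂ) (h : IsSolution κ Y J ψ ψ₁) :
    IsSolution κ Y (z • J) (z • ψ) (z • ψ₁) where
  hasDerivAt x hx := (h.hasDerivAt x hx).const_smul z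
  hasDerivAt_deriv x hx := by
    have := (h.hasDerivAt_deriv x hx).const_smul z
    simpa only [Pi.smul_apply, smul_eq_mul, mul_left_comm] using this
  continuousAt y hy := (h.continuousAt y hy).const_smul z
  jump y hy := by
    obtain ⟨r, l, h1, h2, h3⟩ := h.jump y hy
    refine ⟨z • r, z • l, h1.const_smul z, h2.const_smul z, ?_⟩
    simp only [Pi.smul_apply, smul_eq_mul]
    linear_combination z * h3
  periodic := by
    obtain ⟨c, h1, h2⟩ := h.periodic
    exact ⟨z • c, h1.const_smul z, h2.const_smul z⟩
  periodic_deriv := by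
    obtain ⟨c, h1, h2⟩ := h.periodic_deriv
    exact ⟨z • c, h1.const_smul z, h2.const_smul z⟩

theorem sum {ι : Type*} (s : Finset ι) {J ψ ψ₁ : ι → ℝ → ℂ}
    (h : ∀ i ∈ s, IsSolution κ Y (J i) (ψ i) (ψ₁ i)) :
    IsSolution κ Y (∑ i ∈ s, J i) (∑ i ∈ s, ψ i) (∑ i ∈ s, ψ₁ i) := by
  classical
  induction s using Finset.induction_on with
  | empty => simpa using zero κ Y
  | insert a s ha ih =>
    rw [Finset.sum_insert ha, Finset.sum_insert ha, Finset.sum_insert ha]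
    exact (h a (Finset.mem_insert_self a s)).add
      (ih fun i hi => h i (Finset.mem_insert_of_mem hi))

theorem continuousAt_of_mem (h : IsSolution κ Y J ψ ψ₁) {x : ℝ} (hx : x ∈ loopInterval) :
    ContinuousAt ψ x := by
  by_cases hY : x ∈ Y
  · exact h.continuousAt x hY
  · exact (h.hasDerivAt x ⟨hx, hY⟩).continuousAt

end IsSolution

theorem isOpen_loopInterval_diff (Y : Finset ℝ) : IsOpen (loopInterval \ (Y : Set ℝ)) :=
  isOpen_Ioo.sdiff Y.finite_toSet.isClosed

theorem Icc_subset_closure_loopInterval_diff (Y : Finset ℝ) :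
    Icc 0 (2 * π) ⊆ closure (loopInterval \ (Y : Set ℝ)) := by
  have hd : Dense ((Y : Set ℝ)ᶜ) := Y.finite_toSet.countable.dense_compl ℝ
  have := hd.open_subset_closure_inter (isOpen_Ioo : IsOpen loopInterval)
  calc Icc 0 (2 * π) = closure (Ioo 0 (2 * π)) := (closure_Ioo (by positivity)).symm
    _ ⊆ closure (loopInterval \ (Y : Set ℝ)) := closure_minimal this isClosed_closure

/-- A function with `u' = c u` off a finite set, without jumps and with equal limits at both ends
of the loop, vanishes. -/
theorem eq_zero_of_hasDerivAt_mul (Y : Finset ℝ) {c : ℝ} (hc : c ≠ 0) {u : ℝ → ℂ} {d : ℂ}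
    (hu : ∀ x ∈ loopInterval \ (Y : Set ℝ), HasDerivAt u (c * u x) x)
    (hY : ∀ y ∈ Y, ∃ l, Tendsto u (𝓝[≠] y) (𝓝 l))
    (h0 : Tendsto u (𝓝[>] 0) (𝓝 d)) (h1 : Tendsto u (𝓝[<] (2 * π)) (𝓝 d)) :
    ∀ x ∈ loopInterval \ (Y : Set ℝ), u x = 0 := by
  set A : Set ℝ := loopInterval \ (Y : Set ℝ) with hA
  have hAo : IsOpen A := isOpen_loopInterval_diff Y
  set E : ℝ → ℂ := fun x => Complex.exp (-(c * x)) with hE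
  have hEd : ∀ x : ℝ, HasDerivAt E (-c * E x) x := by
    intro x
    have h := (((hasDerivAt_id x).ofReal_comp.const_mul (c : ℂ)).neg).cexp
    refine h.congr_deriv ?_
    simp [hE, mul_comm]
  have hEc : Continuous E := continuous_iff_continuousAt.2 fun x => (hEd x).continuousAt
  -- With the integrating factor e^{-cx}, the equation becomes w' = 0 off Y.
  set w : ℝ → ℂ := fun x => E x * u x with hw
  have hwd : ∀ x ∈ A, HasDerivAt w 0 x := by
    intro x hx
    refine ((hEd x).mul (hu x hx)).congr_deriv ?_
    ring
  have hw0 : Tendsto w (𝓝[A] 0) (𝓝 (E 0 * d)) :=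
    (((hEc.tendsto 0).mono_left nhdsWithin_le_nhds).mul h0).mono_left
      (nhdsWithin_mono _ fun x hx => hx.1.1)
  have hw1 : Tendsto w (𝓝[A] (2 * π)) (𝓝 (E (2 * π) * d)) :=
    (((hEc.tendsto (2 * π)).mono_left nhdsWithin_le_nhds).mul h1).mono_left
      (nhdsWithin_mono _ fun x hx => hx.1.2)
  have hlim : ∀ x ∈ Icc 0 (2 * π), ∃ l, Tendsto w (𝓝[A] x) (𝓝 l) := by
    intro x hx
    rcases eq_or_lt_of_le hx.1 with rfl | hx0
    · exact ⟨_, hw0⟩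
    rcases eq_or_lt_of_le hx.2 with rfl | hx1
    · exact ⟨_, hw1⟩
    by_cases hxY : x ∈ Y
    · obtain ⟨l, hl⟩ := hY x hxY
      exact ⟨E x * l, (((hEc.tendsto x).mono_left nhdsWithin_le_nhds).mul hl).mono_left
        (nhdsWithin_mono _ fun t ht => by
          rintro rfl
          exact ht.2 hxY)⟩
    · exact ⟨w x, (hwd x ⟨⟨hx0, hx1⟩, hxY⟩).continuousAt.tendsto.mono_left nhdsWithin_le_nhds⟩
  have hcl : Icc 0 (2 * π) ⊆ closure A := Icc_subset_closure_loopInterval_diff Y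
  -- The values of w on Y and at the endpoints are arbitrary; replacing them by limits gives a
  -- function continuous on [0, 2π].
  set f := extendFrom A w with hf
  have hfc : ContinuousOn f (Icc 0 (2 * π)) := continuousOn_extendFrom hcl hlim
  have hfA : ∀ x ∈ A, f x = w x := fun x hx =>
    extendFrom_eq (subset_closure hx)
      ((hwd x hx).continuousAt.tendsto.mono_left nhdsWithin_le_nhds)
  have hfd : ∀ x ∈ A, HasDerivAt f 0 x := fun x hx =>
    (hwd x hx).congr_of_eventuallyEq (by
      filter_upwards [hAo.mem_nhds hx] with t ht using hfA t ht)
  have hconst : ∀ b ∈ Icc 0 (2 * π), f b = f 0 := by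
    intro b hb
    have := integral_eq_of_hasDerivAt_off_countable_of_le f 0 hb.1 Y.finite_toSet.countable
      (hfc.mono (Icc_subset_Icc_right hb.2))
      (fun x hx => hfd x ⟨⟨hx.1.1, hx.1.2.trans_le hb.2⟩, hx.2⟩) (IntervalIntegrable.zero)
    simp only [Pi.zero_apply, intervalIntegral.integral_zero] at this
    exact (sub_eq_zero.1 this.symm)
  have hpi : (0 : ℝ) < 2 * π := by positivity
  have hf0 : f 0 = E 0 * d := extendFrom_eq (hcl ⟨le_rfl, hpi.le⟩) hw0
  have hf1 : f (2 * π) = E (2 * π) * d := extendFrom_eq (hcl ⟨hpi.le, le_rfl⟩) hw1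
  -- Constancy of f gives e^{-2πc} d = d, and c ≠ 0.
  have hd : d = 0 := by
    have h := hconst (2 * π) ⟨hpi.le, le_rfl⟩
    rw [hf0, hf1, ← sub_eq_zero, ← sub_mul, mul_eq_zero] at h
    refine h.resolve_left fun h => ?_
    have e1 : E (2 * π) = ((Real.exp (-(c * (2 * π))) : ℝ) : ℂ) := by simp [hE]
    have e2 : E 0 = 1 := by simp [hE]
    rw [e1, e2, sub_eq_zero] at h
    have h' : Real.exp (-(c * (2 * π))) = 1 := by exact_mod_cast h
    rw [Real.exp_eq_one_iff, neg_eq_zero] at h'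
    rcases mul_eq_zero.1 h' with h' | h'
    · exact hc h'
    · exact hpi.ne' h'
  intro x hx
  have h := hconst x ⟨hx.1.1.le, hx.1.2.le⟩
  rw [hfA x hx, hf0, hd, mul_zero] at h
  exact (mul_eq_zero.1 h).resolve_left (Complex.exp_ne_zero _)

/-- Factor the equation: for s = ±κ the function ψ' + sψ solves u' = su without jumps, so it
vanishes. Subtracting the two cases leaves 2κψ = 0 off Y, and continuity covers Y. -/
theorem IsSolution.eq_zero {κ : ℝ} (hκ : κ ≠ 0) {Y : Finset ℝ} {J ψ ψ₁ : ℝ → ℂ}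
    (h : IsSolution κ Y J ψ ψ₁) (hJ : ∀ y ∈ Y, J y = 0) : ∀ x ∈ loopInterval, ψ x = 0 := by
  obtain ⟨c, c0, c1⟩ := h.periodic
  obtain ⟨d, d0, d1⟩ := h.periodic_deriv
  have key : ∀ s : ℝ, s ≠ 0 → s ^ 2 = κ ^ 2 → ∀ x ∈ loopInterval \ (Y : Set ℝ),
      ψ₁ x + s * ψ x = 0 := by
    intro s hs hs2
    have hs2' : (s : ℂ) ^ 2 = (κ : ℂ) ^ 2 := by exact_mod_cast hs2
    refine eq_zero_of_hasDerivAt_mul (u := fun x => ψ₁ x + s * ψ x) (d := d + s * c) Y hs ?_ ?_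
      (d0.add (c0.const_mul _)) (d1.add (c1.const_mul _))
    · intro x hx
      refine ((h.hasDerivAt_deriv x hx).add ((h.hasDerivAt x hx).const_mul (s : ℂ))).congr_deriv ?_
      linear_combination -ψ x * hs2'
    · intro y hy
      obtain ⟨r, l, hr, hl, hrl⟩ := h.jump y hy
      have hψ := (h.continuousAt y hy).tendsto
      have hrl' : r = l := sub_eq_zero.1 (hrl.trans (hJ y hy))
      subst hrl'
      refine ⟨r + s * ψ y, ?_⟩
      rw [← Iio_union_Ioi, nhdsWithin_union]
      exact (hl.sup hr).add ((hψ.mono_left (sup_le nhdsWithin_le_nhds nhdsWithin_le_nhds)).const_mul _)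
  have hA : ∀ x ∈ loopInterval \ (Y : Set ℝ), ψ x = 0 := by
    intro x hx
    have h1 := key κ hκ rfl x hx
    have h2 := key (-κ) (neg_ne_zero.2 hκ) (by ring) x hx
    have h3 : (2 * κ : ℂ) * ψ x = 0 := by
      push_cast at h2
      linear_combination h1 - h2
    refine (mul_eq_zero.1 h3).resolve_left ?_
    exact mul_ne_zero two_ne_zero (by exact_mod_cast hκ)
  intro x hx
  have hcl := Icc_subset_closure_loopInterval_diff Y ⟨hx.1.le, hx.2.le⟩
  have : (𝓝[loopInterval \ (Y : Set ℝ)] x).NeBot := mem_closure_iff_nhdsWithin_neBot.1 hcl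
  refine tendsto_nhds_unique ((h.continuousAt_of_mem hx).tendsto.mono_left
    (nhdsWithin_le_nhds (s := loopInterval \ (Y : Set ℝ)))) ?_
  refine tendsto_const_nhds.congr' ?_
  filter_upwards [self_mem_nhdsWithin] with t ht using (hA t ht).symm

/-! ### The periodic Green's function. -/

/-- The (unnormalised) periodic Green's function of `-d²/dx² + κ²` as a function of the difference
of two points of `(0, 2π)`. -/
def greenKernel (κ t : ℝ) : ℝ := Real.cosh (κ * (π - |t|))

theorem greenKernel_neg (κ t : ℝ) : greenKernel κ (-t) = greenKernel κ t := by
  rw [greenKernel, greenKernel, abs_neg]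

/-- The derivative of `greenKernel κ` off zero. -/
def greenKernelDeriv (κ t : ℝ) : ℝ :=
  if 0 < t then -(κ * Real.sinh (κ * (π - t))) else κ * Real.sinh (κ * (π + t))

theorem hasDerivAt_cosh_right (κ y x : ℝ) : HasDerivAt (fun t => Real.cosh (κ * (π - (t - y))))
    (-(κ * Real.sinh (κ * (π - (x - y))))) x := by
  have h := ((((hasDerivAt_id x).sub_const y).const_sub π).const_mul κ).cosh
  refine h.congr_deriv ?_
  simp; ring

theorem hasDerivAt_cosh_left (κ y x : ℝ) : HasDerivAt (fun t => Real.cosh (κ * (π + (t - y))))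
    (κ * Real.sinh (κ * (π + (x - y)))) x := by
  have h := ((((hasDerivAt_id x).sub_const y).const_add π).const_mul κ).cosh
  refine h.congr_deriv ?_
  simp; ring

theorem hasDerivAt_sinh_right (κ y x : ℝ) :
    HasDerivAt (fun t => -(κ * Real.sinh (κ * (π - (t - y)))))
    (κ ^ 2 * Real.cosh (κ * (π - (x - y)))) x := by
  have h := (((((hasDerivAt_id x).sub_const y).const_sub π).const_mul κ).sinh.const_mul κ).neg
  refine h.congr_deriv ?_
  simp; ring

theorem hasDerivAt_sinh_left (κ y x : ℝ) :
    HasDerivAt (fun t => κ * Real.sinh (κ * (π + (t - y))))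
    (κ ^ 2 * Real.cosh (κ * (π + (x - y)))) x := by
  have h := ((((hasDerivAt_id x).sub_const y).const_add π).const_mul κ).sinh.const_mul κ
  refine h.congr_deriv ?_
  simp; ring

theorem greenKernel_of_lt {κ x y : ℝ} (h : y < x) :
    greenKernel κ (x - y) = Real.cosh (κ * (π - (x - y))) := by
  rw [greenKernel, abs_of_pos (sub_pos.2 h)]

theorem greenKernel_of_gt {κ x y : ℝ} (h : x < y) :
    greenKernel κ (x - y) = Real.cosh (κ * (π + (x - y))) := by
  rw [greenKernel, abs_of_neg (sub_neg.2 h), sub_neg_eq_add]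

theorem greenKernelDeriv_of_lt {κ x y : ℝ} (h : y < x) :
    greenKernelDeriv κ (x - y) = -(κ * Real.sinh (κ * (π - (x - y)))) := by
  rw [greenKernelDeriv, if_pos (sub_pos.2 h)]

theorem greenKernelDeriv_of_gt {κ x y : ℝ} (h : x < y) :
    greenKernelDeriv κ (x - y) = κ * Real.sinh (κ * (π + (x - y))) := by
  rw [greenKernelDeriv, if_neg (not_lt.2 (sub_neg.2 h).le)]

theorem hasDerivAt_greenKernel (κ : ℝ) {x y : ℝ} (h : x ≠ y) :
    HasDerivAt (fun t => greenKernel κ (t - y)) (greenKernelDeriv κ (x - y)) x := by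
  rcases lt_or_gt_of_ne h with h | h
  · rw [greenKernelDeriv_of_gt h]
    refine (hasDerivAt_cosh_left κ y x).congr_of_eventuallyEq ?_
    filter_upwards [Iio_mem_nhds h] with t ht using greenKernel_of_gt ht
  · rw [greenKernelDeriv_of_lt h]
    refine (hasDerivAt_cosh_right κ y x).congr_of_eventuallyEq ?_
    filter_upwards [Ioi_mem_nhds h] with t ht using greenKernel_of_lt ht

theorem hasDerivAt_greenKernelDeriv (κ : ℝ) {x y : ℝ} (h : x ≠ y) :
    HasDerivAt (fun t => greenKernelDeriv κ (t - y)) (κ ^ 2 * greenKernel κ (x - y)) x := by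
  rcases lt_or_gt_of_ne h with h | h
  · rw [greenKernel_of_gt h]
    refine (hasDerivAt_sinh_left κ y x).congr_of_eventuallyEq ?_
    filter_upwards [Iio_mem_nhds h] with t ht using greenKernelDeriv_of_gt ht
  · rw [greenKernel_of_lt h]
    refine (hasDerivAt_sinh_right κ y x).congr_of_eventuallyEq ?_
    filter_upwards [Ioi_mem_nhds h] with t ht using greenKernelDeriv_of_lt ht

theorem tendsto_greenKernelDeriv_right (κ y : ℝ) :
    Tendsto (fun t => greenKernelDeriv κ (t - y)) (𝓝[>] y) (𝓝 (-(κ * Real.sinh (κ * π)))) := by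
  have h := (hasDerivAt_sinh_right κ y y).continuousAt.tendsto.mono_left
    (nhdsWithin_le_nhds (s := Ioi y))
  rw [sub_self, sub_zero] at h
  refine h.congr' ?_
  filter_upwards [self_mem_nhdsWithin] with t ht using (greenKernelDeriv_of_lt ht).symm

theorem tendsto_greenKernelDeriv_left (κ y : ℝ) :
    Tendsto (fun t => greenKernelDeriv κ (t - y)) (𝓝[<] y) (𝓝 (κ * Real.sinh (κ * π))) := by
  have h := (hasDerivAt_sinh_left κ y y).continuousAt.tendsto.mono_left
    (nhdsWithin_le_nhds (s := Iio y))
  rw [sub_self, add_zero] at h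
  refine h.congr' ?_
  filter_upwards [self_mem_nhdsWithin] with t ht using (greenKernelDeriv_of_gt ht).symm

/-- Across `y₀` the slope drops from κ sinh(κπ) to -κ sinh(κπ). The boundary values match because
cosh is even and sinh is odd about the antipode of `y₀`. -/
theorem isSolution_greenKernel (κ : ℝ) {Y : Finset ℝ} {y₀ : ℝ} (hy₀ : y₀ ∈ Y)
    (hI : y₀ ∈ loopInterval) :
    IsSolution κ Y (Pi.single y₀ ((-(2 * κ * Real.sinh (κ * π)) : ℝ) : ℂ))
      (fun x => (greenKernel κ (x - y₀) : ℂ)) (fun x => (greenKernelDeriv κ (x - y₀) : ℂ)) where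
  hasDerivAt x hx := (hasDerivAt_greenKernel κ (ne_of_mem_of_not_mem (s := Y) hy₀ hx.2).symm).ofReal_comp
  hasDerivAt_deriv x hx := by
    simpa using (hasDerivAt_greenKernelDeriv κ
      (ne_of_mem_of_not_mem (s := Y) hy₀ hx.2).symm).ofReal_comp
  continuousAt y _ := by
    unfold greenKernel
    fun_prop
  jump y _ := by
    by_cases h : y = y₀
    · subst h
      refine ⟨_, _, (Complex.continuous_ofReal.tendsto _).comp (tendsto_greenKernelDeriv_right κ y),
        (Complex.continuous_ofReal.tendsto _).comp (tendsto_greenKernelDeriv_left κ y), ?_⟩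
      rw [Pi.single_eq_same]
      push_cast
      ring
    · have hc := (hasDerivAt_greenKernelDeriv κ h).ofReal_comp.continuousAt.tendsto
      refine ⟨_, _, hc.mono_left nhdsWithin_le_nhds, hc.mono_left nhdsWithin_le_nhds, ?_⟩
      rw [sub_self, Pi.single_eq_of_ne h]
  periodic := by
    have h0 := (hasDerivAt_greenKernel κ hI.1.ne).ofReal_comp.continuousAt.tendsto
    have h1 := (hasDerivAt_greenKernel κ hI.2.ne').ofReal_comp.continuousAt.tendsto
    refine ⟨_, h0.mono_left nhdsWithin_le_nhds, ?_⟩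
    have e : greenKernel κ (2 * π - y₀) = greenKernel κ (0 - y₀) := by
      rw [greenKernel_of_lt hI.2, greenKernel_of_gt hI.1, ← Real.cosh_neg]
      congr 1; ring
    rw [e] at h1
    exact h1.mono_left nhdsWithin_le_nhds
  periodic_deriv := by
    have h0 := (hasDerivAt_greenKernelDeriv κ hI.1.ne).ofReal_comp.continuousAt.tendsto
    have h1 := (hasDerivAt_greenKernelDeriv κ hI.2.ne').ofReal_comp.continuousAt.tendsto
    refine ⟨_, h0.mono_left nhdsWithin_le_nhds, ?_⟩
    have e : greenKernelDeriv κ (2 * π - y₀) = greenKernelDeriv κ (0 - y₀) := by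
      rw [greenKernelDeriv_of_lt hI.2, greenKernelDeriv_of_gt hI.1, ← mul_neg, ← Real.sinh_neg]
      congr 2; ring
    rw [e] at h1
    exact h1.mono_left nhdsWithin_le_nhds

/-- The superposition of Green's functions with weights `v`. -/
theorem isSolution_sum_greenKernel (κ : ℝ) {Y : Finset ℝ} (hY : ∀ y ∈ Y, y ∈ loopInterval)
    (v : ℝ → ℂ) : ∃ J ψ₁ : ℝ → ℂ,
      IsSolution κ Y J (fun x => ∑ y ∈ Y, v y * (greenKernel κ (x - y) : ℂ)) ψ₁ ∧
      ∀ y ∈ Y, J y = -(2 * κ * Real.sinh (κ * π) : ℝ) * v y := by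
  have h := IsSolution.sum Y fun y hy => (isSolution_greenKernel κ hy (hY y hy)).smul (v y)
  refine ⟨∑ y ∈ Y, v y • Pi.single y ((-(2 * κ * Real.sinh (κ * π)) : ℝ) : ℂ),
    ∑ y ∈ Y, v y • fun x => (greenKernelDeriv κ (x - y) : ℂ), ?_, ?_⟩
  · convert h using 1
    ext x
    simp
  · intro y hy
    simp only [Finset.sum_apply, Pi.smul_apply, smul_eq_mul]
    rw [Finset.sum_eq_single y (fun b _ hb => by rw [Pi.single_eq_of_ne hb.symm, mul_zero])
      (fun h => absurd hy h), Pi.single_eq_same]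
    push_cast
    ring

/-! ### Reduction of the eigenvalue problem to a finite matrix (Birman–Schwinger principle). -/

/-- The number `κ` is critical if the matrix of the normalised Green's function at the points of
`Y` has the eigenvalue `-1 / α`. -/
def IsCritical (α : ℝ) (Y : Finset ℝ) (κ : ℝ) : Prop :=
  ∃ v : ℝ → ℝ, (∃ p ∈ Y, v p ≠ 0) ∧
    ∀ p ∈ Y, -α * ∑ q ∈ Y, greenKernel κ (p - q) * v q = 2 * κ * Real.sinh (κ * π) * v p

theorem two_mul_sinh_ne_zero {κ : ℝ} (hκ : 0 < κ) : 2 * κ * Real.sinh (κ * π) ≠ 0 := by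
  have : 0 < Real.sinh (κ * π) := Real.sinh_pos_iff.2 (by positivity)
  positivity

/-- The superposition of Green's functions with weights v jumps by -2κ sinh(κπ) v(p) at p; the
eigenvector equation says that this is α times its value there. In particular it is nonzero wherever
v is. -/
theorem IsCritical.exists_isSolution {α κ : ℝ} {Y : Finset ℝ} (hκ : 0 < κ)
    (hY : ∀ y ∈ Y, y ∈ loopInterval) (h : IsCritical α Y κ) :
    ∃ ψ ψ₁ : ℝ → ℂ, IsSolution κ Y (fun y => α * ψ y) ψ ψ₁ ∧ Continuous ψ ∧
      ∃ x ∈ loopInterval, ψ x ≠ 0 := by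
  obtain ⟨v, ⟨p, hp, hvp⟩, hv⟩ := h
  obtain ⟨J, ψ₁, hsol, hJ⟩ := isSolution_sum_greenKernel κ hY fun y => (v y : ℂ)
  have key : ∀ q ∈ Y, (α : ℂ) * ∑ y ∈ Y, (v y : ℂ) * (greenKernel κ (q - y) : ℂ) =
      -(2 * κ * Real.sinh (κ * π) : ℝ) * v q := by
    intro q hq
    have := congrArg (fun r : ℝ => (r : ℂ)) (hv q hq)
    push_cast at this ⊢
    simp only [mul_comm (v _ : ℂ)] at this ⊢
    linear_combination -this
  refine ⟨_, ψ₁, ⟨hsol.1, hsol.2, hsol.3, fun y hy => ?_, hsol.5, hsol.6⟩, ?_, p, hY p hp, ?_⟩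
  · obtain ⟨r, l, hr, hl, hrl⟩ := hsol.jump y hy
    exact ⟨r, l, hr, hl, by rw [hrl, hJ y hy, key y hy]⟩
  · unfold greenKernel
    fun_prop
  · intro h0
    have h1 := key p hp
    rw [h0, mul_zero] at h1
    have h2 : (2 * κ * Real.sinh (κ * π)) * v p = 0 := by
      have : -(2 * κ * Real.sinh (κ * π)) * v p = 0 := by exact_mod_cast h1.symm
      linarith
    exact (mul_ne_zero (two_mul_sinh_ne_zero hκ) hvp) h2

/-- Adding to a multiple of ψ the superposition with weights αψ(q) cancels all jumps, so the sum
vanishes by uniqueness. Thus ψ is determined by its values on Y, and these form an eigenvector. -/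
theorem IsSolution.isCritical {α κ : ℝ} {Y : Finset ℝ} {ψ ψ₁ : ℝ → ℂ} (hκ : 0 < κ)
    (hY : ∀ y ∈ Y, y ∈ loopInterval) (h : IsSolution κ Y (fun y => α * ψ y) ψ ψ₁)
    (hψ : ∃ x ∈ loopInterval, ψ x ≠ 0) : IsCritical α Y κ := by
  obtain ⟨J, φ₁, hsol, hJ⟩ := isSolution_sum_greenKernel κ hY fun y => α * ψ y
  have hc := two_mul_sinh_ne_zero hκ
  set c : ℝ := 2 * κ * Real.sinh (κ * π) with hcdef
  have hzero := (((h.smul (c : ℂ)).add hsol).eq_zero hκ.ne' fun y hy => by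
    simp only [Pi.add_apply, Pi.smul_apply, hJ y hy, smul_eq_mul]
    ring)
  have rep : ∀ x ∈ loopInterval,
      -(α : ℂ) * ∑ q ∈ Y, (greenKernel κ (x - q) : ℂ) * ψ q = c * ψ x := by
    intro x hx
    have := hzero x hx
    simp only [Pi.add_apply, Pi.smul_apply, smul_eq_mul, mul_assoc, ← Finset.mul_sum] at this
    simp only [mul_comm (greenKernel _ _ : ℂ)]
    linear_combination -this
  have hne : ∃ p ∈ Y, ψ p ≠ 0 := by
    by_contra! hall
    obtain ⟨x, hx, hx0⟩ := hψ
    have := rep x hx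
    rw [Finset.sum_eq_zero fun q hq => by rw [hall q hq, mul_zero], mul_zero] at this
    exact mul_ne_zero (by exact_mod_cast hc) hx0 this.symm
  obtain ⟨p, hp, hp0⟩ := hne
  -- The matrix is real, so the real and imaginary parts of the eigenvector satisfy the same
  -- equation; one of them is nonzero at p.
  by_cases hre : (ψ p).re = 0
  · refine ⟨fun y => (ψ y).im, ⟨p, hp, fun him => hp0 (Complex.ext hre him)⟩, fun q hq => ?_⟩
    simpa [Complex.im_sum] using congrArg Complex.im (rep q (hY q hq))
  · refine ⟨fun y => (ψ y).re, ⟨p, hp, hre⟩, fun q hq => ?_⟩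
    simpa [Complex.re_sum] using congrArg Complex.re (rep q (hY q hq))

/-! ### From the unbounded operator in L² to classical solutions and back. -/

theorem exists_isInDomain_of_mem_energyLevels {α E : ℝ} {Y : Finset ℝ}
    (h : E ∈ energyLevels α Y) : ∃ ψ ψ₁ ψ₂ : ℝ → ℂ, IsInDomain α Y ψ ψ₁ ψ₂ ∧
      ¬ ψ =ᵐ[volume.restrict loopInterval] 0 ∧
      ψ₂ =ᵐ[volume.restrict loopInterval] fun x => -(E : ℂ) * ψ x := by
  obtain ⟨f, hf, hE⟩ := h
  have hg := (hamiltonian α Y).mem_graph f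
  rw [hamiltonian_graph, hE] at hg
  obtain ⟨ψ, ψ₁, ψ₂, hd, h1, h2⟩ := hg
  refine ⟨ψ, ψ₁, ψ₂, hd, fun h0 => hf ?_, ?_⟩
  · exact (Lp.eq_zero_iff_ae_eq_zero).2 (h1.trans h0)
  · filter_upwards [h1, h2, Lp.coeFn_smul (E : ℂ) (f : LoopL2)] with x hx1 hx2 hx3
    simp only [Pi.smul_apply, smul_eq_mul, Pi.neg_apply] at hx1 hx2 hx3
    rw [hx3, hx1] at hx2
    linear_combination hx2

theorem mem_energyLevels_of_isInDomain {α E : ℝ} {Y : Finset ℝ} {ψ ψ₁ : ℝ → ℂ}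
    (hψ : MemLp ψ 2 ((volume : Measure ℝ).restrict loopInterval))
    (hd : IsInDomain α Y ψ ψ₁ (fun x => -(E : ℂ) * ψ x))
    (h0 : ¬ ψ =ᵐ[volume.restrict loopInterval] 0) : E ∈ energyLevels α Y := by
  have hg : (hψ.toLp ψ, (E : ℂ) • hψ.toLp ψ) ∈ (hamiltonian α Y).graph := by
    rw [hamiltonian_graph]
    refine ⟨ψ, ψ₁, _, hd, hψ.coeFn_toLp, ?_⟩
    filter_upwards [hψ.coeFn_toLp, Lp.coeFn_smul (E : ℂ) (hψ.toLp ψ)] with x hx1 hx2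
    simp only [Pi.smul_apply, smul_eq_mul, Pi.neg_apply] at hx1 hx2 ⊢
    rw [hx2, hx1]
    ring
  obtain ⟨f, hf1, hf2⟩ := (LinearPMap.mem_graph_iff _).1 hg
  simp only at hf1 hf2
  refine ⟨f, fun hf => h0 ?_, by rw [hf2, hf1]⟩
  rw [hf1, Lp.eq_zero_iff_ae_eq_zero] at hf
  exact hψ.coeFn_toLp.symm.trans hf

/-- Regularity: ψ'' agrees almost everywhere with the continuous function κ²ψ, so the fundamental
theorem of calculus makes ψ' differentiable at every point off Y. -/
theorem IsInDomain.isSolution {α κ : ℝ} {Y : Finset ℝ} {ψ ψ₁ ψ₂ : ℝ → ℂ}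
    (h : IsInDomain α Y ψ ψ₁ ψ₂)
    (hE : ψ₂ =ᵐ[volume.restrict loopInterval] fun x => (κ : ℂ) ^ 2 * ψ x) :
    IsSolution κ Y (fun y => α * ψ y) ψ ψ₁ where
  hasDerivAt := h.hasDerivAt
  continuousAt := h.continuousAt
  jump := h.jump
  periodic := h.periodic
  periodic_deriv := h.periodic_deriv
  hasDerivAt_deriv x hx := by
    have hopen := isOpen_loopInterval_diff Y
    obtain ⟨ε, hε, hball⟩ := Metric.isOpen_iff.1 hopen x hx
    have hconv := (convex_ball x ε).ordConnected
    set g : ℝ → ℂ := fun t => (κ : ℂ) ^ 2 * ψ t with hg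
    have hgc : ContinuousOn g (Metric.ball x ε) := fun t ht =>
      ((h.hasDerivAt t (hball ht)).continuousAt.const_mul _).continuousWithinAt
    have key : ∀ a ∈ Metric.ball x ε, ∀ b ∈ Metric.ball x ε, a ≤ b →
        ψ₁ b - ψ₁ a = ∫ t in a..b, g t := by
      intro a ha b hb hab
      have hs := (hconv.out ha hb).trans hball
      rw [h.integral_eq a b hab hs]
      refine intervalIntegral.integral_congr_ae ?_
      rw [EventuallyEq, loopInterval, ae_restrict_iff' measurableSet_Ioo] at hE
      filter_upwards [hE] with t ht hts
      rw [uIoc_of_le hab] at hts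
      exact ht (hs ⟨hts.1.le, hts.2⟩).1
    have hxb := Metric.mem_ball_self (x := x) hε
    have hFTC : HasDerivAt (fun b => ψ₁ x + ∫ t in x..b, g t) (g x) x := by
      refine HasDerivAt.const_add _ (intervalIntegral.integral_hasDerivAt_right ?_ ?_ ?_)
      · simp
      · exact hgc.stronglyMeasurableAtFilter Metric.isOpen_ball x hxb
      · exact hgc.continuousAt (Metric.ball_mem_nhds x hε)
    refine hFTC.congr_of_eventuallyEq ?_
    filter_upwards [Metric.ball_mem_nhds x hε] with b hb
    rcases le_total x b with hle | hle
    · rw [← key x hxb b hb hle]; ring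
    · rw [intervalIntegral.integral_symm, ← key b hb x hxb hle]; ring

theorem IsSolution.isInDomain {α κ : ℝ} {Y : Finset ℝ} {ψ ψ₁ : ℝ → ℂ}
    (h : IsSolution κ Y (fun y => α * ψ y) ψ ψ₁) (hc : Continuous ψ)
    (hL : MemLp ψ 2 ((volume : Measure ℝ).restrict loopInterval)) :
    IsInDomain α Y ψ ψ₁ (fun x => (κ : ℂ) ^ 2 * ψ x) where
  hasDerivAt := h.hasDerivAt
  memLp := hL.const_mul _
  integral_eq a b hab hs := by
    refine (intervalIntegral.integral_eq_sub_of_hasDerivAt (fun x hx => ?_) ?_).symm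
    · rw [uIcc_of_le hab] at hx
      exact h.hasDerivAt_deriv x (hs hx)
    · exact (hc.const_mul _).intervalIntegrable _ _
  continuousAt := h.continuousAt
  jump := h.jump
  periodic := h.periodic
  periodic_deriv := h.periodic_deriv

theorem neg_sq_mem_energyLevels_iff {α κ : ℝ} {Y : Finset ℝ} (hκ : 0 < κ)
    (hY : ∀ y ∈ Y, y ∈ loopInterval) : -κ ^ 2 ∈ energyLevels α Y ↔ IsCritical α Y κ := by
  constructor
  · intro h
    obtain ⟨ψ, ψ₁, ψ₂, hd, h0, hE⟩ := exists_isInDomain_of_mem_energyLevels h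
    have hsol : IsSolution κ Y (fun y => α * ψ y) ψ ψ₁ := hd.isSolution (by
      filter_upwards [hE] with x hx
      rw [hx]
      push_cast
      ring)
    refine hsol.isCritical hκ hY ?_
    by_contra! hall
    refine h0 ?_
    rw [EventuallyEq, loopInterval, ae_restrict_iff' measurableSet_Ioo]
    exact Eventually.of_forall hall
  · intro h
    obtain ⟨ψ, ψ₁, hsol, hc, x, hx, hx0⟩ := h.exists_isSolution hκ hY
    have hL : MemLp ψ 2 ((volume : Measure ℝ).restrict loopInterval) := by
      obtain ⟨C, hC⟩ := (isCompact_Icc (a := (0 : ℝ)) (b := 2 * π)).exists_bound_of_continuousOn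
        hc.continuousOn
      have : IsFiniteMeasure ((volume : Measure ℝ).restrict loopInterval) :=
        ⟨by rw [Measure.restrict_apply_univ]; exact measure_Ioo_lt_top⟩
      refine MemLp.of_bound hc.aestronglyMeasurable C ?_
      rw [loopInterval, ae_restrict_iff' measurableSet_Ioo]
      exact Eventually.of_forall fun t ht => hC t (Ioo_subset_Icc_self ht)
    refine mem_energyLevels_of_isInDomain hL (ψ₁ := ψ₁) ?_ ?_
    · convert hsol.isInDomain hc hL using 3
      push_cast
      ring
    · intro h0
      exact hx0 (Measure.eqOn_open_of_ae_eq h0 isOpen_Ioo hc.continuousOn continuousOn_const hx)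

/-- If `κ` is the greatest critical number, then `-κ²` is the lowest energy level. -/
theorem isLeast_energyLevels {α κ : ℝ} {Y : Finset ℝ} (hY : ∀ y ∈ Y, y ∈ loopInterval)
    (hκ : IsGreatest {k | 0 < k ∧ IsCritical α Y k} κ) :
    IsLeast (energyLevels α Y) (-κ ^ 2) := by
  refine ⟨(neg_sq_mem_energyLevels_iff hκ.1.1 hY).2 hκ.1.2, fun E hE => ?_⟩
  by_contra! hlt
  -- A competitor below -κ² is itself negative, so the nonnegative part of the spectrum needs no
  -- analysis.
  have hE0 : 0 < -E := by nlinarith [sq_nonneg κ]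
  have hs : Real.sqrt (-E) ^ 2 = -E := Real.sq_sqrt hE0.le
  have hcrit : IsCritical α Y (Real.sqrt (-E)) :=
    (neg_sq_mem_energyLevels_iff (Real.sqrt_pos.2 hE0) hY).1 (by rwa [hs, neg_neg])
  have hle := hκ.2 ⟨Real.sqrt_pos.2 hE0, hcrit⟩
  have := pow_le_pow_left₀ (Real.sqrt_nonneg _) hle 2
  linarith

/-! ### Variational description of the greatest critical number. -/

/-- The quadratic form whose maximum over the unit sphere vanishes at critical numbers. -/
def greenForm (α : ℝ) (Y : Finset ℝ) (κ : ℝ) (v : Y → ℝ) : ℝ :=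
  ∑ p : Y, v p * (-α * ∑ q : Y, greenKernel κ (p - q) * v q - 2 * κ * Real.sinh (κ * π) * v p)

/-- The gradient of `greenForm` (up to a factor two). -/
def greenGrad (α : ℝ) (Y : Finset ℝ) (κ : ℝ) (v : Y → ℝ) (p : Y) : ℝ :=
  -α * ∑ q : Y, greenKernel κ (p - q) * v q - 2 * κ * Real.sinh (κ * π) * v p

/-- The unit sphere of the space of real functions on `Y`. -/
def unitVectors (Y : Finset ℝ) : Set (Y → ℝ) := {v | ∑ p, v p ^ 2 = 1}

/-- The maximum of `greenForm` over the unit sphere. -/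
def greenMax (α : ℝ) (Y : Finset ℝ) (κ : ℝ) : ℝ := sSup (greenForm α Y κ '' unitVectors Y)

theorem isCompact_unitVectors (Y : Finset ℝ) : IsCompact (unitVectors Y) := by
  refine Metric.isCompact_of_isClosed_isBounded ?_ ?_
  · exact isClosed_eq (by fun_prop) continuous_const
  · refine (Metric.isBounded_closedBall (x := (0 : Y → ℝ)) (r := 1)).subset fun v hv => ?_
    rw [mem_closedBall_zero_iff, pi_norm_le_iff_of_nonneg zero_le_one]
    intro p
    have h : v p ^ 2 ≤ ∑ q, v q ^ 2 :=
      Finset.single_le_sum (f := fun q => v q ^ 2) (fun q _ => sq_nonneg _) (Finset.mem_univ p)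
    have hv' : ∑ q, v q ^ 2 = 1 := hv
    rw [Real.norm_eq_abs, ← sq_le_one_iff_abs_le_one]
    linarith

theorem continuous_greenForm (α : ℝ) (Y : Finset ℝ) :
    Continuous fun x : ℝ × (Y → ℝ) => greenForm α Y x.1 x.2 := by
  unfold greenForm greenKernel
  fun_prop

theorem continuous_greenMax (α : ℝ) (Y : Finset ℝ) : Continuous (greenMax α Y) :=
  (isCompact_unitVectors Y).continuous_sSup (continuous_greenForm α Y)

theorem greenForm_smul (α : ℝ) (Y : Finset ℝ) (κ t : ℝ) (v : Y → ℝ) :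
    greenForm α Y κ (t • v) = t ^ 2 * greenForm α Y κ v := by
  simp only [greenForm, Pi.smul_apply, smul_eq_mul, Finset.mul_sum, mul_left_comm _ t]
  refine Finset.sum_congr rfl fun p _ => ?_
  simp only [← Finset.mul_sum]
  ring

theorem greenForm_le_greenMax (α : ℝ) (Y : Finset ℝ) (κ : ℝ) (v : Y → ℝ) :
    greenForm α Y κ v ≤ greenMax α Y κ * ∑ p, v p ^ 2 := by
  by_cases hv : ∑ p, v p ^ 2 = 0
  · have h0 : v = 0 := by
      ext p
      exact pow_eq_zero_iff two_ne_zero |>.1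
        ((Finset.sum_eq_zero_iff_of_nonneg fun q _ => sq_nonneg (v q)).1 hv p (Finset.mem_univ p))
    simp [h0, greenForm]
  have hpos : 0 < ∑ p, v p ^ 2 :=
    lt_of_le_of_ne (Finset.sum_nonneg fun q _ => sq_nonneg _) (Ne.symm hv)
  set s := ∑ p, v p ^ 2 with hs
  have hsq : Real.sqrt s ^ 2 = s := Real.sq_sqrt hpos.le
  have hmem : (Real.sqrt s)⁻¹ • v ∈ unitVectors Y := by
    simp only [unitVectors, mem_ofPred_eq, Pi.smul_apply, smul_eq_mul, mul_pow, ← Finset.mul_sum]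
    rw [← hs, inv_pow, hsq, inv_mul_cancel₀ hv]
  have hcont : Continuous (greenForm α Y κ) := (continuous_greenForm α Y).comp (.prodMk_right κ)
  have h := le_csSup ((isCompact_unitVectors Y).image hcont).bddAbove (mem_image_of_mem _ hmem)
  rw [greenForm_smul, inv_pow, hsq, inv_mul_le_iff₀ hpos] at h
  rw [mul_comm]
  exact h

theorem exists_greenForm_eq_greenMax (α : ℝ) {Y : Finset ℝ} (hY : Y.Nonempty) (κ : ℝ) :
    ∃ v ∈ unitVectors Y, greenForm α Y κ v = greenMax α Y κ := by
  obtain ⟨y, hy⟩ := hY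
  have hne : (unitVectors Y).Nonempty := ⟨Pi.single ⟨y, hy⟩ 1, by
    simp [unitVectors, Pi.single_apply]⟩
  have hcont : Continuous (greenForm α Y κ) := (continuous_greenForm α Y).comp (.prodMk_right κ)
  exact ((isCompact_unitVectors Y).image hcont).sSup_mem (hne.image _)

/-- The expansion is exact since the form is quadratic; symmetry of the kernel turns the linear
coefficient into twice the squared norm of the gradient. -/
theorem greenForm_add_smul_greenGrad (α : ℝ) (Y : Finset ℝ) (κ t : ℝ) (v : Y → ℝ) :
    greenForm α Y κ (v + t • greenGrad α Y κ v) = greenForm α Y κ v +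
      2 * t * ∑ p, greenGrad α Y κ v p ^ 2 + t ^ 2 * greenForm α Y κ (greenGrad α Y κ v) := by
  set g := greenGrad α Y κ v with hg
  have hform : ∀ w, greenForm α Y κ w = ∑ p, w p * greenGrad α Y κ w p := fun w => rfl
  have hlin : ∀ p, greenGrad α Y κ (v + t • g) p = g p + t * greenGrad α Y κ g p := by
    intro p
    rw [hg]
    simp only [greenGrad, Pi.add_apply, Pi.smul_apply, smul_eq_mul, mul_add,
      Finset.sum_add_distrib, mul_left_comm _ t]
    simp only [← Finset.mul_sum]
    ring
  have hsymm : ∑ p, v p * greenGrad α Y κ g p = ∑ p, g p ^ 2 := by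
    have h1 : ∑ p : Y, v p * ∑ q : Y, greenKernel κ (p - q) * g q =
        ∑ p : Y, g p * ∑ q : Y, greenKernel κ (p - q) * v q := by
      simp only [Finset.mul_sum]
      rw [Finset.sum_comm]
      refine Finset.sum_congr rfl fun p _ => Finset.sum_congr rfl fun q _ => ?_
      rw [← greenKernel_neg, neg_sub]
      ring
    have h2 : ∀ p, g p ^ 2 = -α * (g p * ∑ q : Y, greenKernel κ (p - q) * v q)
        - 2 * κ * Real.sinh (κ * π) * (v p * g p) := by
      intro p
      rw [sq]
      nth_rewrite 2 [hg]
      rw [greenGrad]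
      ring
    simp only [h2, Finset.sum_sub_distrib, ← Finset.mul_sum, ← h1]
    simp only [greenGrad, mul_sub, Finset.sum_sub_distrib, mul_left_comm (v _), ← Finset.mul_sum]
  have hsq : ∑ p, g p * g p = ∑ p, g p ^ 2 := Finset.sum_congr rfl fun p _ => (sq _).symm
  have hvg : greenForm α Y κ v = ∑ p, v p * g p := rfl
  rw [hform, hvg, hform g]
  simp only [hlin, Pi.add_apply, Pi.smul_apply, smul_eq_mul]
  have hexp : ∀ p, (v p + t * g p) * (g p + t * greenGrad α Y κ g p) =
      v p * g p + t * (v p * greenGrad α Y κ g p) + t * (g p * g p) +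
        t ^ 2 * (g p * greenGrad α Y κ g p) := fun p => by ring
  simp only [hexp, Finset.sum_add_distrib, ← Finset.mul_sum, hsymm, hsq]
  ring

/-- A maximiser has value 0 and the form is nowhere positive, so its gradient g vanishes: moving
along g changes the form by 2t|g|² + O(t²). Vanishing of g is the eigenvector equation. -/
theorem isCritical_of_greenMax_eq_zero {α κ : ℝ} {Y : Finset ℝ} (hY : Y.Nonempty)
    (h : greenMax α Y κ = 0) : IsCritical α Y κ := by
  obtain ⟨v, hv, hv0⟩ := exists_greenForm_eq_greenMax α hY κ
  rw [h] at hv0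
  have hle : ∀ w, greenForm α Y κ w ≤ 0 := fun w => by
    simpa [h] using greenForm_le_greenMax α Y κ w
  have hsum : ∑ p, greenGrad α Y κ v p ^ 2 = 0 := by
    -- The negated form along v + tg is a nonnegative quadratic in t without constant term, so its
    -- linear coefficient is zero.
    have hd := discrim_le_zero (K := ℝ) (a := -greenForm α Y κ (greenGrad α Y κ v))
      (b := -(2 * ∑ p, greenGrad α Y κ v p ^ 2)) (c := 0) fun t => by
        have := hle (v + t • greenGrad α Y κ v)
        rw [greenForm_add_smul_greenGrad, hv0] at this
        linarith
    rw [discrim] at hd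
    have : (2 * ∑ p, greenGrad α Y κ v p ^ 2) ^ 2 = 0 :=
      le_antisymm (by linarith) (sq_nonneg _)
    simpa using this
  have hgrad : ∀ p, greenGrad α Y κ v p = 0 := fun p => pow_eq_zero_iff two_ne_zero |>.1
    ((Finset.sum_eq_zero_iff_of_nonneg fun q _ => sq_nonneg _).1 hsum p (Finset.mem_univ p))
  have hext : ∀ p : Y, (fun x : ℝ => if hx : x ∈ Y then v ⟨x, hx⟩ else 0) p = v p := fun p => by
    simp
  refine ⟨fun x => if hx : x ∈ Y then v ⟨x, hx⟩ else 0, ?_, fun p hp => ?_⟩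
  · by_contra! hall
    have hv1 : ∑ p, v p ^ 2 = 1 := hv
    rw [Finset.sum_eq_zero fun p _ => by
      rw [← hext p]
      exact (pow_eq_zero_iff two_ne_zero).2 (hall p p.2)] at hv1
    exact zero_ne_one hv1
  · have := hgrad ⟨p, hp⟩
    rw [greenGrad, sub_eq_zero] at this
    rw [hext ⟨p, hp⟩, ← this, ← Finset.sum_coe_sort]
    simp only [hext]

theorem IsCritical.greenMax_nonneg {α κ : ℝ} {Y : Finset ℝ} (h : IsCritical α Y κ) :
    0 ≤ greenMax α Y κ := by
  obtain ⟨v, ⟨p, hp, hvp⟩, hv⟩ := h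
  have h0 : greenForm α Y κ (fun q => v q) = 0 := by
    refine Finset.sum_eq_zero fun q _ => ?_
    have := hv q q.2
    rw [← Finset.sum_coe_sort] at this
    rw [this, sub_self, mul_zero]
  have hle := greenForm_le_greenMax α Y κ fun q => v q
  rw [h0] at hle
  have hpos : 0 < ∑ q : Y, v q ^ 2 :=
    Finset.sum_pos' (fun q _ => sq_nonneg _) ⟨⟨p, hp⟩, Finset.mem_univ _, by positivity⟩
  exact nonneg_of_mul_nonneg_left hle hpos

theorem greenForm_one (α : ℝ) (Y : Finset ℝ) (κ : ℝ) : greenForm α Y κ 1 =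
    -α * ∑ p ∈ Y, ∑ q ∈ Y, greenKernel κ (p - q) - Y.card * (2 * κ * Real.sinh (κ * π)) := by
  simp only [greenForm, Pi.one_apply, one_mul, mul_one, Finset.sum_sub_distrib, ← Finset.mul_sum]
  rw [← Finset.sum_coe_sort Y]
  simp [← Finset.sum_coe_sort Y, mul_left_comm, mul_assoc]

/-- At κ = 0 the kernel is identically 1 and the sinh term drops out. -/
theorem greenMax_zero_pos {α : ℝ} (hα : α < 0) {Y : Finset ℝ} (hY : Y.Nonempty) :
    0 < greenMax α Y 0 := by
  have h := greenForm_le_greenMax α Y 0 1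
  rw [greenForm_one] at h
  have hc : (0 : ℝ) < Y.card := by exact_mod_cast hY.card_pos
  simp [greenKernel] at h
  by_contra! hle
  nlinarith [mul_pos (neg_pos.2 hα) (mul_pos hc hc)]

theorem cosh_le_two_mul_sinh {x : ℝ} (hx : 1 ≤ x) : Real.cosh x ≤ 2 * Real.sinh x := by
  have h1 := Real.add_one_le_exp x
  have h2 : Real.exp x * Real.exp (-x) = 1 := by rw [← Real.exp_add]; simp
  rw [Real.cosh_eq, Real.sinh_eq]
  nlinarith [Real.exp_pos (-x)]

theorem greenKernel_le {κ p q : ℝ} (hp : p ∈ loopInterval) (hq : q ∈ loopInterval) :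
    greenKernel κ (p - q) ≤ Real.cosh (κ * π) := by
  rw [greenKernel, Real.cosh_le_cosh, abs_mul, abs_mul, abs_of_pos pi_pos]
  refine mul_le_mul_of_nonneg_left ?_ (abs_nonneg κ)
  have h : |p - q| ≤ 2 * π := abs_le.2 ⟨by linarith [hp.1, hq.2], by linarith [hp.2, hq.1]⟩
  exact abs_le.2 ⟨by linarith, by linarith [abs_nonneg (p - q)]⟩

theorem greenForm_le {α κ : ℝ} (hα : α < 0) {Y : Finset ℝ} (hY : ∀ y ∈ Y, y ∈ loopInterval)
    (v : Y → ℝ) : greenForm α Y κ v ≤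
      (-α * Y.card * Real.cosh (κ * π) - 2 * κ * Real.sinh (κ * π)) * ∑ p, v p ^ 2 := by
  have hterm : ∀ p q : Y, greenKernel κ (p - q) * (v p * v q) ≤
      Real.cosh (κ * π) * ((v p ^ 2 + v q ^ 2) / 2) := by
    intro p q
    have h1 := greenKernel_le (κ := κ) (hY p p.2) (hY q q.2)
    have h2 : 0 < greenKernel κ (p - q) := Real.cosh_pos _
    calc greenKernel κ (p - q) * (v p * v q)
        ≤ greenKernel κ (p - q) * ((v p ^ 2 + v q ^ 2) / 2) :=
          mul_le_mul_of_nonneg_left (by linarith [sq_nonneg (v p - v q)]) h2.le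
      _ ≤ _ := mul_le_mul_of_nonneg_right h1 (by positivity)
  have hsum : ∑ p : Y, ∑ q : Y, greenKernel κ (p - q) * (v p * v q) ≤
      Real.cosh (κ * π) * (Y.card * ∑ p, v p ^ 2) := by
    refine (Finset.sum_le_sum fun p _ => Finset.sum_le_sum fun q _ => hterm p q).trans_eq ?_
    simp only [← Finset.mul_sum, ← Finset.sum_div, Finset.sum_add_distrib, Finset.sum_const,
      Finset.card_univ, Fintype.card_coe, nsmul_eq_mul]
    ring
  have hform : greenForm α Y κ v = -α * ∑ p : Y, ∑ q : Y, greenKernel κ (p - q) * (v p * v q) -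
      2 * κ * Real.sinh (κ * π) * ∑ p, v p ^ 2 := by
    simp only [greenForm, Finset.mul_sum, ← Finset.sum_sub_distrib, mul_sub]
    refine Finset.sum_congr rfl fun p _ => ?_
    congr 1
    · exact Finset.sum_congr rfl fun q _ => by ring
    · ring
  rw [hform]
  have := mul_le_mul_of_nonneg_left hsum (neg_pos.2 hα).le
  linarith

/-- For large κ the term 2κ sinh(κπ) ≥ κ cosh(κπ) outweighs the bound -α|Y| cosh(κπ) for the kernel
part. -/
theorem greenMax_neg {α κ : ℝ} (hα : α < 0) {Y : Finset ℝ} (hne : Y.Nonempty)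
    (hY : ∀ y ∈ Y, y ∈ loopInterval) (h1 : 1 ≤ κ) (hκ : -α * Y.card < κ) :
    greenMax α Y κ < 0 := by
  obtain ⟨v, hv, hv0⟩ := exists_greenForm_eq_greenMax α hne κ
  have h := greenForm_le (κ := κ) hα hY v
  have hv1 : ∑ p, v p ^ 2 = 1 := hv
  rw [hv0, hv1, mul_one] at h
  have hc := cosh_le_two_mul_sinh (x := κ * π) (by nlinarith [pi_gt_three])
  have hpos := Real.cosh_pos (κ * π)
  nlinarith

/-- There is a greatest critical number, and it is bounded below by trial vectors. -/
theorem exists_isGreatest_isCritical {α : ℝ} (hα : α < 0) {Y : Finset ℝ} (hne : Y.Nonempty)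
    (hY : ∀ y ∈ Y, y ∈ loopInterval) :
    ∃ κ, IsGreatest {k | 0 < k ∧ IsCritical α Y k} κ ∧
      (∀ k, 0 < k → 0 ≤ greenForm α Y k 1 → k ≤ κ) ∧
      ∀ k, 0 < k → 0 < greenForm α Y k 1 → k < κ := by
  have hcont := continuous_greenMax α Y
  set T : Set ℝ := {k | 0 ≤ greenMax α Y k} with hT
  have hTc : IsClosed T := isClosed_le continuous_const hcont
  have h0 : (0 : ℝ) ∈ T := (greenMax_zero_pos hα hne).le
  have hbdd : BddAbove T := by
    refine ⟨max 1 (-α * Y.card + 1), fun k hk => ?_⟩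
    by_contra! hlt
    rw [max_lt_iff] at hlt
    exact absurd (greenMax_neg hα hne hY hlt.1.le (by linarith)) (not_lt.2 hk)
  set κ := sSup T with hκ
  have hmem : κ ∈ T := hTc.csSup_mem ⟨0, h0⟩ hbdd
  have hle : ∀ k ∈ T, k ≤ κ := fun k hk => le_csSup hbdd hk
  -- If the maximum were positive at the supremum, continuity would keep it positive slightly to the
  -- right.
  have hzero : greenMax α Y κ = 0 := by
    refine le_antisymm ?_ hmem
    by_contra! hpos
    obtain ⟨k, hk1, hk2⟩ := ((hcont.continuousAt.eventually (lt_mem_nhds hpos)).filter_mono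
      (nhdsWithin_le_nhds (s := Ioi κ)) |>.and self_mem_nhdsWithin).exists
    exact absurd (hle k (le_of_lt hk1)) (not_le.2 hk2)
  have hκ0 : 0 < κ := lt_of_le_of_ne (hle 0 h0) fun h => by
    rw [← h] at hzero
    exact (greenMax_zero_pos hα hne).ne' hzero
  have hcard : (0 : ℝ) < ∑ p : Y, (1 : Y → ℝ) p ^ 2 := by
    simpa using hne
  refine ⟨κ, ⟨⟨hκ0, isCritical_of_greenMax_eq_zero hne hzero⟩,
    fun k hk => hle k hk.2.greenMax_nonneg⟩, fun k _ hk => hle k ?_, fun k _ hk => ?_⟩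
  · exact nonneg_of_mul_nonneg_left (hk.trans (greenForm_le_greenMax α Y k 1)) hcard
  · have hpos := pos_of_mul_pos_left (hk.trans_le (greenForm_le_greenMax α Y k 1)) hcard.le
    refine lt_of_le_of_ne (hle k hpos.le) fun h => ?_
    rw [h, hzero] at hpos
    exact hpos.false

/-! ### Cyclically ordered points and Jensen's inequality. -/

/-- A configuration of `N` points on the loop, continued to a quasi-periodic sequence. -/
structure IsLoopSequence (N : ℕ) (z : ℕ → ℝ) : Prop where
  strictMono : StrictMono z
  add_period : ∀ n, z (n + N) = z n + 2 * π

theorem sum_range_add_of_periodic {N : ℕ} {F : ℕ → ℝ} (hF : ∀ n, F (n + N) = F n) (i : ℕ) :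
    ∑ k ∈ Finset.range N, F (i + k) = ∑ k ∈ Finset.range N, F k := by
  induction i with
  | zero => simp
  | succ i ih =>
    rw [← ih]
    have h1 := Finset.sum_range_succ (fun k => F (i + k)) N
    have h2 := Finset.sum_range_succ' (fun k => F (i + k)) N
    rw [h1, hF] at h2
    simp only [add_zero] at h2
    rw [add_left_inj] at h2
    rw [h2]
    exact Finset.sum_congr rfl fun k _ => by congr 1; ring

theorem strictConvexOn_cosh_mul {κ : ℝ} (hκ : 0 < κ) :
    StrictConvexOn ℝ univ fun t => Real.cosh (κ * (π - t)) := by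
  refine strictConvexOn_univ_of_deriv2_pos (by fun_prop) fun x => ?_
  have h1 : deriv (fun t => Real.cosh (κ * (π - t))) = fun t => -(κ * Real.sinh (κ * (π - t))) := by
    ext t
    simpa using (hasDerivAt_cosh_right κ 0 t).deriv
  have h2 : deriv (fun t => -(κ * Real.sinh (κ * (π - t)))) x = κ ^ 2 * Real.cosh (κ * (π - x)) := by
    simpa using (hasDerivAt_sinh_right κ 0 x).deriv
  rw [Function.iterate_succ, Function.iterate_one, Function.comp_apply, h1, h2]
  have := Real.cosh_pos (κ * (π - x))
  positivity

namespace IsLoopSequence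

variable {N : ℕ} {z : ℕ → ℝ}

/-- The N arcs made of k consecutive gaps cover the loop k times. -/
theorem sum_sub (h : IsLoopSequence N z) (k : ℕ) :
    ∑ i ∈ Finset.range N, (z (i + k) - z i) = 2 * π * k := by
  induction k with
  | zero => simp
  | succ k ih =>
    have h1 := Finset.sum_range_succ (fun i => z (i + k)) N
    have h2 := Finset.sum_range_succ' (fun i => z (i + k)) N
    rw [h1, zero_add, add_comm N k, h.add_period] at h2
    rw [Finset.sum_sub_distrib] at ih ⊢
    have e : ∑ i ∈ Finset.range N, z (i + (k + 1)) = ∑ i ∈ Finset.range N, z (i + 1 + k) :=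
      Finset.sum_congr rfl fun i _ => by congr 1; ring
    rw [e]
    push_cast
    linarith

theorem le_sum_cosh (h : IsLoopSequence N z) (hN : 0 < N) {κ : ℝ} (hκ : 0 < κ) (k : ℕ) :
    N * Real.cosh (κ * (π - 2 * π * k / N)) ≤
      ∑ i ∈ Finset.range N, Real.cosh (κ * (π - (z (i + k) - z i))) ∧
    (N * Real.cosh (κ * (π - 2 * π * k / N)) =
      ∑ i ∈ Finset.range N, Real.cosh (κ * (π - (z (i + k) - z i))) →
      ∀ i < N, z (i + k) - z i = 2 * π * k / N) := by
  have hN' : (0 : ℝ) < N := by exact_mod_cast hN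
  have hconv := strictConvexOn_cosh_mul hκ
  set p : ℕ → ℝ := fun i => z (i + k) - z i with hp
  have hw : ∑ i ∈ Finset.range N, (N : ℝ)⁻¹ = 1 := by
    simp [hN'.ne']
  have hmean : ∑ i ∈ Finset.range N, (N : ℝ)⁻¹ • p i = 2 * π * k / N := by
    rw [← Finset.smul_sum, h.sum_sub, smul_eq_mul]
    field_simp
  have hJ := hconv.convexOn.map_sum_le (t := Finset.range N) (w := fun _ => (N : ℝ)⁻¹) (p := p)
    (fun i _ => by positivity) hw (fun i _ => mem_univ _)
  have hE := hconv.eq_of_le_map_sum (t := Finset.range N) (w := fun _ => (N : ℝ)⁻¹) (p := p)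
    (fun i _ => by positivity) hw (fun i _ => mem_univ _)
  simp only [hmean] at hJ hE
  simp only [smul_eq_mul, ← Finset.mul_sum] at hJ hE
  rw [inv_mul_le_iff₀ hN'] at hE
  rw [← div_eq_inv_mul, le_div_iff₀ hN', mul_comm] at hJ
  refine ⟨hJ, fun heq i hi => ?_⟩
  -- Strict convexity makes all the arcs equal; their total then fixes the common length.
  have hall := hE heq.ge
  have hsum := h.sum_sub k
  rw [Finset.sum_congr rfl fun j hj => hall hj (Finset.mem_range.2 hi)] at hsum
  rw [Finset.sum_const, Finset.card_range, nsmul_eq_mul] at hsum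
  rw [eq_div_iff hN'.ne', mul_comm]
  exact hsum

/-- Summing the Green's function over all points of the configuration. -/
theorem sum_greenKernel (h : IsLoopSequence N z) (κ : ℝ) {i : ℕ} (hi : i < N) :
    ∑ j ∈ Finset.range N, greenKernel κ (z i - z j) =
      ∑ k ∈ Finset.range N, Real.cosh (κ * (π - (z (i + k) - z i))) := by
  -- Reducing the index modulo N makes the summand periodic, so the summation may start at i.
  set F : ℕ → ℝ := fun n => greenKernel κ (z i - z (n % N)) with hF
  have h1 : ∑ j ∈ Finset.range N, greenKernel κ (z i - z j) = ∑ j ∈ Finset.range N, F j :=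
    Finset.sum_congr rfl fun j hj => by rw [hF]; simp only [Nat.mod_eq_of_lt (Finset.mem_range.1 hj)]
  rw [h1, ← sum_range_add_of_periodic (F := F) (fun n => by simp [hF]) i]
  refine Finset.sum_congr rfl fun k hk => ?_
  rw [Finset.mem_range] at hk
  simp only [hF]
  rcases lt_or_ge (i + k) N with hlt | hge
  · rw [Nat.mod_eq_of_lt hlt, greenKernel, abs_sub_comm,
      abs_of_nonneg (sub_nonneg.2 (h.strictMono.monotone (Nat.le_add_right i k)))]
  · obtain ⟨m, hm⟩ := Nat.exists_eq_add_of_le hge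
    have hmi : m < i := by omega
    have hmod : (i + k) % N = m := by
      rw [hm, Nat.add_mod_left, Nat.mod_eq_of_lt (hmi.trans hi)]
    -- Past index N the forward arc is 2π minus the distance in the interval; this flips the sign
    -- inside the even function cosh.
    have hz : z (i + k) = z m + 2 * π := by rw [hm, add_comm N m, h.add_period]
    rw [hmod, hz, greenKernel, abs_of_pos (sub_pos.2 (h.strictMono hmi)), ← Real.cosh_neg]
    congr 1
    ring

theorem injOn (h : IsLoopSequence N z) : Set.InjOn z (Finset.range N : Set ℕ) :=
  h.strictMono.injective.injOn

theorem sum_sum_greenKernel (h : IsLoopSequence N z) (hN : 2 ≤ N) {κ : ℝ} (hκ : 0 < κ) :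
    N * ∑ k ∈ Finset.range N, Real.cosh (κ * (π - 2 * π * k / N)) ≤
      ∑ i ∈ Finset.range N, ∑ j ∈ Finset.range N, greenKernel κ (z i - z j) ∧
    (N * ∑ k ∈ Finset.range N, Real.cosh (κ * (π - 2 * π * k / N)) =
      ∑ i ∈ Finset.range N, ∑ j ∈ Finset.range N, greenKernel κ (z i - z j) →
      ∀ i < N, z i = z 0 + 2 * π / N * i) := by
  rw [Finset.sum_congr rfl fun i hi => h.sum_greenKernel κ (Finset.mem_range.1 hi),
    Finset.sum_comm, Finset.mul_sum]
  have hle := fun k => h.le_sum_cosh (by omega) hκ k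
  refine ⟨Finset.sum_le_sum fun k _ => (hle k).1, fun heq => ?_⟩
  -- Equality in the total forces equality for each k; k = 1 gives equal gaps and is available
  -- because N ≥ 2.
  have h1 := (Finset.sum_eq_sum_iff_of_le fun k _ => (hle k).1).1 heq 1 (Finset.mem_range.2 (by omega))
  have hgap := (hle 1).2 h1
  intro i
  induction i with
  | zero => simp
  | succ i ih =>
    intro hi
    have := hgap i (by omega)
    have ih' := ih (by omega)
    push_cast at this ⊢
    rw [ih'] at this
    linear_combination this

end IsLoopSequence

/-- Sort Y and add 2π after every N steps; strict monotonicity across a turn holds because Y lies in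
an open interval of length 2π. -/
theorem exists_isLoopSequence {N : ℕ} (hN : 0 < N) {Y : Finset ℝ} (hcard : Y.card = N)
    (hY : ∀ y ∈ Y, y ∈ loopInterval) :
    ∃ z, IsLoopSequence N z ∧ (Finset.range N).image z = Y := by
  set e := Y.orderEmbOfFin hcard with he
  have hmem : ∀ i, e i ∈ loopInterval := fun i => hY _ (Finset.orderEmbOfFin_mem Y hcard i)
  refine ⟨fun n => e ⟨n % N, Nat.mod_lt n hN⟩ + 2 * π * (n / N : ℕ), ⟨?_, ?_⟩, ?_⟩
  · intro m n hmn
    have hdiv : m / N ≤ n / N := Nat.div_le_div_right hmn.le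
    rcases hdiv.eq_or_lt with heq | hlt
    · have hmod : m % N < n % N := by
        have h1 := Nat.div_add_mod m N
        have h2 := Nat.div_add_mod n N
        rw [heq] at h1
        omega
      have : e ⟨m % N, Nat.mod_lt m hN⟩ < e ⟨n % N, Nat.mod_lt n hN⟩ := e.strictMono hmod
      simp only [heq]
      linarith
    · have h1 := (hmem ⟨m % N, Nat.mod_lt m hN⟩).2
      have h2 := (hmem ⟨n % N, Nat.mod_lt n hN⟩).1
      have h3 : ((m / N : ℕ) : ℝ) + 1 ≤ (n / N : ℕ) := by exact_mod_cast hlt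
      have h4 := mul_le_mul_of_nonneg_left h3 (by positivity : (0 : ℝ) ≤ 2 * π)
      simp only
      linarith
  · intro n
    simp only [Nat.add_mod_right, Nat.add_div_right n hN]
    push_cast
    ring
  · ext y
    simp only [Finset.mem_image, Finset.mem_range]
    constructor
    · rintro ⟨n, hn, rfl⟩
      simp only [Nat.div_eq_of_lt hn, Nat.cast_zero, mul_zero, add_zero]
      exact Finset.orderEmbOfFin_mem Y hcard _
    · intro hy
      have : y ∈ Set.range e := by rw [he, Finset.range_orderEmbOfFin]; exact hy
      obtain ⟨i, rfl⟩ := this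
      refine ⟨i, i.2, ?_⟩
      simp [Nat.mod_eq_of_lt i.2, Nat.div_eq_of_lt i.2]

/-! ### The equidistant configuration and its row sums. -/

/-- The quasi-periodic continuation of the equidistant configuration. -/
def equidistantSequence (N n : ℕ) : ℝ := π / N * (2 * n + 1)

theorem isLoopSequence_equidistantSequence {N : ℕ} (hN : 0 < N) :
    IsLoopSequence N (equidistantSequence N) := by
  have hN' : (0 : ℝ) < N := by exact_mod_cast hN
  refine ⟨fun m n hmn => ?_, fun n => ?_⟩
  · have : (m : ℝ) < n := by exact_mod_cast hmn
    exact mul_lt_mul_of_pos_left (by linarith) (by positivity)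
  · simp only [equidistantSequence]
    push_cast
    field_simp
    ring

theorem image_equidistantSequence (N : ℕ) :
    (Finset.range N).image (equidistantSequence N) = equidistant N := by
  ext y
  simp only [equidistant, Finset.mem_image, Finset.mem_range, Finset.mem_Icc, equidistantSequence]
  constructor
  · rintro ⟨n, hn, rfl⟩
    exact ⟨n + 1, ⟨by omega, by omega⟩, by push_cast; ring⟩
  · rintro ⟨j, hj, rfl⟩
    refine ⟨j - 1, by omega, ?_⟩
    rw [Nat.cast_sub hj.1]
    push_cast
    ring

theorem card_equidistant {N : ℕ} (hN : 0 < N) : (equidistant N).card = N := by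
  rw [← image_equidistantSequence,
    Finset.card_image_of_injOn (isLoopSequence_equidistantSequence hN).injOn, Finset.card_range]

theorem equidistant_subset_loopInterval {N : ℕ} {y : ℝ} (hy : y ∈ equidistant N) :
    y ∈ loopInterval := by
  rw [← image_equidistantSequence, Finset.mem_image] at hy
  obtain ⟨n, hn, rfl⟩ := hy
  rw [Finset.mem_range] at hn
  have hN' : (0 : ℝ) < N := by exact_mod_cast (Nat.zero_le n).trans_lt hn
  have hn' : (n : ℝ) + 1 ≤ N := by exact_mod_cast hn
  unfold equidistantSequence
  refine ⟨by positivity, ?_⟩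
  calc π / N * (2 * n + 1) < π / N * (2 * N) :=
        mul_lt_mul_of_pos_left (by linarith) (by positivity)
    _ = 2 * π := by field_simp

theorem sum_greenKernel_equidistant {N : ℕ} (hN : 0 < N) (κ : ℝ) {p : ℝ}
    (hp : p ∈ equidistant N) : ∑ q ∈ equidistant N, greenKernel κ (p - q) =
      ∑ k ∈ Finset.range N, Real.cosh (κ * (π - 2 * π * k / N)) := by
  have hz := isLoopSequence_equidistantSequence hN
  rw [← image_equidistantSequence] at hp ⊢
  obtain ⟨i, hi, rfl⟩ := Finset.mem_image.1 hp
  rw [Finset.sum_image hz.injOn, hz.sum_greenKernel κ (Finset.mem_range.1 hi)]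
  refine Finset.sum_congr rfl fun k _ => ?_
  congr 3
  simp only [equidistantSequence]
  push_cast
  ring

/-- A matrix with nonnegative entries and constant row sums has no eigenvalue above them. -/
theorem IsCritical.le_of_rowSum {α κ m : ℝ} (hα : α < 0) {Y : Finset ℝ} (h : IsCritical α Y κ)
    (hm : ∀ p ∈ Y, ∑ q ∈ Y, greenKernel κ (p - q) = m) :
    2 * κ * Real.sinh (κ * π) ≤ -α * m := by
  obtain ⟨v, ⟨p₀, hp₀, hvp₀⟩, hv⟩ := h
  -- Evaluating the eigenvector equation where |v| is largest bounds the eigenvalue by the row sum.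
  obtain ⟨p, hp, hmax⟩ := Y.exists_max_image (fun q => |v q|) ⟨p₀, hp₀⟩
  have hpos : 0 < |v p| := (abs_pos.2 hvp₀).trans_le (hmax p₀ hp₀)
  have hsum : |∑ q ∈ Y, greenKernel κ (p - q) * v q| ≤ m * |v p| := by
    rw [← hm p hp, Finset.sum_mul]
    refine (Finset.abs_sum_le_sum_abs _ _).trans (Finset.sum_le_sum fun q hq => ?_)
    have hg : 0 < greenKernel κ (p - q) := Real.cosh_pos _
    rw [abs_mul, abs_of_pos hg]
    exact mul_le_mul_of_nonneg_left (hmax q hq) hg.le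
  have h1 := congrArg abs (hv p hp)
  rw [abs_mul, abs_mul, abs_of_pos (neg_pos.2 hα)] at h1
  have h2 := mul_le_mul_of_nonneg_left hsum (neg_pos.2 hα).le
  rw [h1, ← mul_assoc] at h2
  exact (le_abs_self _).trans (le_of_mul_le_mul_right h2 hpos)

/-! ### Invariance under congruence. -/

/-- The loop distance is either |p - q| or 2π minus it, and the two choices give opposite arguments
of cosh. This makes the kernel invariant under isometries of the loop. -/
theorem greenKernel_eq_cosh_dist (κ : ℝ) {p q : ℝ} (hp : p ∈ loopInterval)
    (hq : q ∈ loopInterval) : greenKernel κ (p - q) =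
      Real.cosh (κ * (π - dist (p : AddCircle (2 * π)) (q : AddCircle (2 * π)))) := by
  have hpi : (0 : ℝ) < 2 * π := by positivity
  rw [dist_eq_norm, ← AddCircle.coe_sub]
  have key : ∀ t : ℝ, 0 ≤ t → t < 2 * π →
      greenKernel κ t = Real.cosh (κ * (π - ‖(t : AddCircle (2 * π))‖)) := by
    intro t ht0 ht1
    rw [greenKernel, abs_of_nonneg ht0]
    rcases le_total t π with h | h
    · rw [(AddCircle.norm_coe_eq_abs_iff _ hpi.ne').2, abs_of_nonneg ht0]
      rw [abs_of_nonneg ht0, abs_of_pos hpi]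
      linarith
    · have e : (t : AddCircle (2 * π)) = ((t - 2 * π : ℝ) : AddCircle (2 * π)) := by
        rw [AddCircle.coe_sub, AddCircle.coe_period, sub_zero]
      rw [e, (AddCircle.norm_coe_eq_abs_iff _ hpi.ne').2, abs_of_neg (by linarith),
        ← Real.cosh_neg]
      · congr 1; ring
      · rw [abs_of_neg (by linarith), abs_of_pos hpi]
        linarith
  rcases le_total q p with h | h
  · exact key _ (sub_nonneg.2 h) (by linarith [hp.2, hq.1])
  · rw [← greenKernel_neg, neg_sub, key _ (sub_nonneg.2 h) (by linarith [hp.1, hq.2]),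
      ← neg_sub q p, AddCircle.coe_neg, norm_neg]

theorem coe_injOn_loopInterval :
    Set.InjOn (fun y : ℝ => (y : AddCircle (2 * π))) loopInterval := by
  have : Fact (0 < 2 * π) := ⟨by positivity⟩
  intro x hx y hy hxy
  refine (AddCircle.coe_eq_coe_iff_of_mem_Ico (p := 2 * π) (a := 0) ?_ ?_).1 hxy <;>
    rw [zero_add]
  · exact Ioo_subset_Ico_self hx
  · exact Ioo_subset_Ico_self hy

theorem Congruent.symm {Y Z : Finset ℝ} (h : Congruent Y Z) : Congruent Z Y := by
  obtain ⟨e, he⟩ := h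
  refine ⟨e.symm, ?_⟩
  rw [← he, image_image]
  simp

/-- The isometry induces a kernel-preserving bijection σ from Y to Z, along which eigenvectors pull
back. -/
theorem IsCritical.of_congruent {α κ : ℝ} {Y Z : Finset ℝ} (hY : ∀ y ∈ Y, y ∈ loopInterval)
    (hZ : ∀ z ∈ Z, z ∈ loopInterval) (hc : Congruent Y Z) (h : IsCritical α Z κ) :
    IsCritical α Y κ := by
  obtain ⟨e, he⟩ := hc
  have hex : ∀ y ∈ Y, ∃ z ∈ Z, (z : AddCircle (2 * π)) = e (y : AddCircle (2 * π)) := by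
    intro y hy
    have : e (y : AddCircle (2 * π)) ∈ (fun y : ℝ => (y : AddCircle (2 * π))) '' (Z : Set ℝ) := by
      rw [← he]
      exact mem_image_of_mem _ (mem_image_of_mem _ hy)
    exact this
  choose! σ hσZ hσ using hex
  have hinj : Set.InjOn σ (Y : Set ℝ) := by
    intro y hy y' hy' hyy
    refine coe_injOn_loopInterval (hY y hy) (hY y' hy') (e.injective ?_)
    simp only
    rw [← hσ y hy, ← hσ y' hy', hyy]
  have himg : Y.image σ = Z := by
    ext z
    rw [Finset.mem_image]
    constructor
    · rintro ⟨y, hy, rfl⟩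
      exact hσZ y hy
    · intro hz
      have : (z : AddCircle (2 * π)) ∈
          e '' ((fun y : ℝ => (y : AddCircle (2 * π))) '' (Y : Set ℝ)) := by
        rw [he]
        exact mem_image_of_mem _ hz
      obtain ⟨_, ⟨y, hy, rfl⟩, hyz⟩ := this
      refine ⟨y, hy, coe_injOn_loopInterval (hZ _ (hσZ y hy)) (hZ z hz) ?_⟩
      simp only at hyz ⊢
      rw [hσ y hy, hyz]
  have hker : ∀ p ∈ Y, ∀ q ∈ Y, greenKernel κ (σ p - σ q) = greenKernel κ (p - q) := by
    intro p hp q hq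
    rw [greenKernel_eq_cosh_dist κ (hZ _ (hσZ p hp)) (hZ _ (hσZ q hq)),
      greenKernel_eq_cosh_dist κ (hY p hp) (hY q hq), hσ p hp, hσ q hq, e.dist_eq]
  obtain ⟨v, ⟨p₀, hp₀, hv₀⟩, hv⟩ := h
  rw [← himg] at hp₀
  obtain ⟨y₀, hy₀, rfl⟩ := Finset.mem_image.1 hp₀
  refine ⟨fun y => v (σ y), ⟨y₀, hy₀, hv₀⟩, fun p hp => ?_⟩
  have := hv (σ p) (hσZ p hp)
  rw [← himg, Finset.sum_image hinj] at this
  rw [← this]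
  congr 1
  exact Finset.sum_congr rfl fun q hq => by rw [hker p hp q hq]

/-- A configuration with equal gaps is a rotation of the equidistant one. -/
theorem congruent_equidistant_of_gaps {N : ℕ} {z : ℕ → ℝ}
    (hz : ∀ i < N, z i = z 0 + 2 * π / N * i) :
    Congruent ((Finset.range N).image z) (equidistant N) := by
  rw [← image_equidistantSequence]
  -- This rotation takes the first point to π/N, the first equidistant point.
  refine ⟨IsometryEquiv.addRight ((π / N - z 0 : ℝ) : AddCircle (2 * π)), ?_⟩
  simp only [Finset.coe_image, image_image]
  refine image_congr fun i hi => ?_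
  rw [Finset.mem_coe, Finset.mem_range] at hi
  simp only [IsometryEquiv.addRight_apply, equidistantSequence]
  rw [← AddCircle.coe_add, hz i hi]
  congr 1
  ring

end PointInteraction

end

/-! ### Comparison of the two ground states. -/

theorem mainTheorem3 (N : ℕ) (hN : 2 ≤ N) (α : ℝ) (hα : α < 0) (Y : Finset ℝ)
    (hYcard : Y.card = N) (hY : ∀ y ∈ Y, y ∈ Set.Ioo 0 (2 * Real.pi)) :
    IsLeast (PointInteraction.energyLevels α Y) (PointInteraction.groundState α Y) ∧
    IsLeast (PointInteraction.energyLevels α (PointInteraction.equidistant N))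
      (PointInteraction.groundState α (PointInteraction.equidistant N)) ∧
    PointInteraction.groundState α Y ≤
      PointInteraction.groundState α (PointInteraction.equidistant N) ∧
    (PointInteraction.groundState α Y <
        PointInteraction.groundState α (PointInteraction.equidistant N) ↔
      ¬ PointInteraction.Congruent Y (PointInteraction.equidistant N)) := by
  have hYne : Y.Nonempty := Finset.card_pos.1 (by omega)
  have hN0 : 0 < N := by omega
  have hEcard := PointInteraction.card_equidistant hN0
  have hEI : ∀ y ∈ PointInteraction.equidistant N, y ∈ PointInteraction.loopInterval :=
    fun y hy => PointInteraction.equidistant_subset_loopInterval hy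
  obtain ⟨κ, hκ, hκle, hκlt⟩ := PointInteraction.exists_isGreatest_isCritical hα hYne hY
  obtain ⟨k, hk, -, -⟩ := PointInteraction.exists_isGreatest_isCritical hα
    (Finset.card_pos.1 (by omega : 0 < (PointInteraction.equidistant N).card)) hEI
  have hk0 : 0 < k := hk.1.1
  have hκ0 : 0 < κ := hκ.1.1
  have hlY := PointInteraction.isLeast_energyLevels hY hκ
  have hlE := PointInteraction.isLeast_energyLevels hEI hk
  have hgY : PointInteraction.groundState α Y = -κ ^ 2 := hlY.csInf_eq
  have hgE : PointInteraction.groundState α (PointInteraction.equidistant N) = -k ^ 2 :=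
    hlE.csInf_eq
  obtain ⟨z, hz, rfl⟩ := PointInteraction.exists_isLoopSequence hN0 hYcard hY
  have hrow := hk.1.2.le_of_rowSum hα fun p hp =>
    PointInteraction.sum_greenKernel_equidistant hN0 k hp
  obtain ⟨hsum, hsum_eq⟩ := hz.sum_sum_greenKernel hN hk0
  have hform := PointInteraction.greenForm_one α ((Finset.range N).image z) k
  simp only [Finset.sum_image hz.injOn, hYcard] at hform
  have hNpos : (0 : ℝ) < N := by exact_mod_cast hN0
  have hα' : 0 < -α := neg_pos.2 hα
  have hrow' := mul_le_mul_of_nonneg_left hrow hNpos.le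
  -- The row-sum bound at k and Jensen's inequality together make the form of Y nonnegative at the
  -- constant vector.
  have hle : k ≤ κ := hκle k hk0 (by
    rw [hform]
    linarith [mul_le_mul_of_nonneg_left hsum hα'.le])
  have hlt : ¬ PointInteraction.Congruent ((Finset.range N).image z)
      (PointInteraction.equidistant N) → k < κ := fun hc => hκlt k hk0 (by
    rw [hform]
    have := lt_of_le_of_ne hsum fun h =>
      hc (PointInteraction.congruent_equidistant_of_gaps (hsum_eq h))
    linarith [mul_lt_mul_of_pos_left this hα'])
  -- Under congruence κ is critical for the equidistant set too, so it cannot exceed k.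
  have hcong : PointInteraction.Congruent ((Finset.range N).image z)
      (PointInteraction.equidistant N) → ¬ k < κ := fun hc =>
    not_lt.2 (hk.2 ⟨hκ0, hκ.1.2.of_congruent hEI hY hc.symm⟩)
  rw [hgY, hgE]
  refine ⟨hlY, hlE, neg_le_neg (pow_le_pow_left₀ hk0.le hle 2), fun h hc => ?_, fun hc => ?_⟩
  · exact hcong hc (lt_of_pow_lt_pow_left₀ 2 hκ0.le (neg_lt_neg_iff.1 h))
  · exact neg_lt_neg (pow_lt_pow_left₀ (hlt hc) hk0.le two_ne_zero)
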